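/- For integers $1\le k\le n$ let $\Theta_k\subset\mathbb{R}^n$ be the set of vectors with at most $k$ constant pieces, i.e. of all $\theta\in\mathbb{R}^n$ for which there exist integers $0=a_0\le a_1\le\cdots\le a_k=n$ and reals $\mu_1,\dots,\mu_k$ with $\theta_i=\mu_j$ for all integers $i$ with $a_{j-1}<i\le a_j$, $1\le j\le k$ (no monotonicity of the $\mu_j$ is required). For $\sigma>0$ put $$R_n(k,\sigma)=\inf_{\widehat\theta}\sup_{\theta^*\in\Theta_k}\mathbb{E}\,\|\widehat\theta(X)-\theta^*\|^2,$$ where $\|\cdot\|$ is the Euclidean norm, the infimum is over all measurable functions $\widehat\theta:\mathbb{R}^n\to\mathbb{R}^n$ of the observation $X$, and the expectation (in $[0,\infty]$) is taken under $X\sim N(\theta^*,\sigma^2I_n)$. Let $$r_n(k,\sigma)=\begin{cases}\sigma^2, & k=1,\\ \sigma^2\log\log(16n), & k=2,\\ \sigma^2k\log(en/k), & k\ge 3.\end{cases}$$ Then there exist universal constants $c,C>0$ such that for all integers $1\le k\le n$ and all $\sigma>0$, $$c\,r_n(k,\sigma)\;\le\;R_n(k,\sigma)\;\le\;C\,r_n(k,\sigma).$$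 -/

import Mathlib

open MeasureTheory ProbabilityTheory
open scoped ENNReal

noncomputable section

namespace PiecewiseConstant

/-- The class `Θ_k` of vectors in `ℝⁿ` with at most `k` constant pieces: there are integers
`0 = a_0 ≤ a_1 ≤ ⋯ ≤ a_k = n` and reals `μ_1, …, μ_k` such that `θ_i = μ_j` for every integer `i`
with `a_{j-1} < i ≤ a_j`.  The coordinate number `i + 1` is indexed by `i : Fin n`, and the piece
number `j + 1` by `j : Fin k`. -/
def Theta (n k : ℕ) : Set (EuclideanSpace ℝ (Fin n)) :=
  {θ | ∃ (a : Fin (k + 1) → ℕ) (μ : Fin k → ℝ),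
    a 0 = 0 ∧ Monotone a ∧ a (Fin.last k) = n ∧
    ∀ (j : Fin k) (i : Fin n), (i : ℕ) + 1 ∈ Set.Ioc (a j.castSucc) (a j.succ) → θ i = μ j}

/-- The risk `𝔼 ‖θ̂(X) - θ‖²` of an estimator under `X ∼ N(θ, σ² I_n)`, with values in `[0, ∞]`. -/
def risk (n : ℕ) (σ : ℝ) (est : EuclideanSpace ℝ (Fin n) → EuclideanSpace ℝ (Fin n))
    (θ : EuclideanSpace ℝ (Fin n)) : ℝ≥0∞ :=
  ∫⁻ x, ENNReal.ofReal (‖est x - θ‖ ^ 2)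
    ∂(multivariateGaussian θ (σ ^ 2 • (1 : Matrix (Fin n) (Fin n) ℝ)))

/-- The minimax risk over a parameter set `T`: infimum over all measurable functions of the
observation of the supremum over `θ ∈ T` of the risk. -/
def minimaxRisk (n : ℕ) (σ : ℝ) (T : Set (EuclideanSpace ℝ (Fin n))) : ℝ≥0∞ :=
  ⨅ (est : EuclideanSpace ℝ (Fin n) → EuclideanSpace ℝ (Fin n)) (_ : Measurable est),
    ⨆ θ ∈ T, risk n σ est θ

/-- The rate `σ²` for `k = 1`, `σ² log log (16 n)` for `k = 2`, `σ² k log (e n / k)` for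
`k ≥ 3` (only used for `1 ≤ k ≤ n`). -/
def rate (n k : ℕ) (σ : ℝ) : ℝ :=
  if k = 1 then σ ^ 2
  else if k = 2 then σ ^ 2 * Real.log (Real.log (16 * n))
  else σ ^ 2 * k * Real.log (Real.exp 1 * n / k)

end PiecewiseConstant

end

/-! Upper bounds. `Θ_k` lies in a finite union of subspaces `V i`, and the estimator is least
squares over that union. If `w` is the fit and `u = w - θ`, minimality gives `‖u‖² ≤ 2σ⟨z, u⟩`, so
the loss is at most `4σ²` times the supremum of `⟨z, u⟩² / ‖u‖²`
(`minimaxRisk_le_of_forall_inner_sq_le`). For `k = 1` and `k ≥ 3` this supremum is a maximum of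
squared norms of Gaussian projections onto spaces of dimension `O(k)`; a union bound with
exponential moments costs the log of the number of subspaces, at most `k log(en/k)`
(`minimaxRisk_le_of_subset_iUnion_submodule`). For `k = 2` the union bound would give `log n`. Here
`u` has three constant pieces, each an interval anchored at `0`, at the true jump `p` or at `n`, so
only normalized Gaussian sums along four increasing chains matter. Lévy's inequality controls each
dyadic range of lengths at constant cost, and a union bound over about `log n` ranges gives `log log
n` (`exists_coordSum_sq_le`, `exists_inner_sub_sq_le`).

Lower bounds. In each of several disjoint blocks the signal is zero or a uniformly chosen `σ • v b
j`. If the `χ²`-divergence of the mixture from the null is bounded, no test tells them apart, so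
each block costs a constant times the squared signal norm (`le_minimaxRisk_of_blocks`). For `k = 1`
there is one constant vector; for `k = 2`, one block with prefixes of lengths `4 ^ j` and common
norm, whose correlations decay geometrically, so that about `log n` nearly orthogonal alternatives
allow energy of order `log log n`; for `k ≥ 3`, about `k / 2` blocks with one spike each at an
unknown place, allowing energy of order `log(n/k)` per block. -/

set_option linter.unusedSectionVars false

namespace PiecewiseConstant

/-! ### Standard Gaussian measure: density, translation, exponential moments. -/

section Gaussian

variable {E : Type*} [NormedAddCommGroup E] [InnerProductSpace ℝ E] [FiniteDimensional ℝ E]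
  [MeasurableSpace E] [BorelSpace E]

lemma integrable_exp_neg_mul_norm_sq {b : ℝ} (hb : 0 < b) :
    Integrable (fun x : E ↦ Real.exp (-b * ‖x‖ ^ 2)) := by
  have h := (GaussianFourier.integrable_cexp_neg_mul_sq_norm_add (b := (b : ℂ)) (V := E)
    (by simpa using hb) 0 0).norm
  refine h.congr (Filter.Eventually.of_forall fun x ↦ ?_)
  simp only [Complex.norm_exp]
  congr 1
  simp [← Complex.ofReal_pow]

lemma lintegral_exp_neg_mul_norm_sq {b : ℝ} (hb : 0 < b) :
    ∫⁻ x : E, ENNReal.ofReal (Real.exp (-b * ‖x‖ ^ 2)) =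
      ENNReal.ofReal ((Real.pi / b) ^ (Module.finrank ℝ E / 2 : ℝ)) := by
  rw [← GaussianFourier.integral_rexp_neg_mul_sq_norm hb,
    ofReal_integral_eq_lintegral_ofReal (integrable_exp_neg_mul_norm_sq hb)
      (Filter.Eventually.of_forall fun x ↦ (Real.exp_pos _).le)]

variable (E) in
/-- The density of the standard Gaussian measure on a Euclidean space. -/
noncomputable def stdGaussianDensity (x : E) : ℝ :=
  ((2 * Real.pi) ^ (Module.finrank ℝ E / 2 : ℝ))⁻¹ * Real.exp (-(1 / 2) * ‖x‖ ^ 2)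

lemma stdGaussianDensity_nonneg (x : E) : 0 ≤ stdGaussianDensity E x := by
  unfold stdGaussianDensity; positivity

@[fun_prop]
lemma measurable_stdGaussianDensity : Measurable (stdGaussianDensity E) := by
  unfold stdGaussianDensity; fun_prop

lemma lintegral_stdGaussianDensity :
    ∫⁻ x : E, ENNReal.ofReal (stdGaussianDensity E x) = 1 := by
  simp_rw [stdGaussianDensity, ENNReal.ofReal_mul (inv_nonneg.2 (show (0 : ℝ) ≤
    (2 * Real.pi) ^ (Module.finrank ℝ E / 2 : ℝ) by positivity))]
  rw [lintegral_const_mul _ (by fun_prop), lintegral_exp_neg_mul_norm_sq (by norm_num),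
    ← ENNReal.ofReal_mul (by positivity)]
  rw [show Real.pi / (1 / 2) = 2 * Real.pi by ring, inv_mul_cancel₀ (by positivity),
    ENNReal.ofReal_one]

lemma stdGaussian_eq_withDensity :
    stdGaussian E = volume.withDensity (fun x ↦ ENNReal.ofReal (stdGaussianDensity E x)) := by
  have : IsFiniteMeasure
      (volume.withDensity (fun x : E ↦ ENNReal.ofReal (stdGaussianDensity E x))) :=
    isFiniteMeasure_withDensity (by rw [lintegral_stdGaussianDensity]; simp)
  apply Measure.ext_of_charFun
  ext t
  rw [charFun_stdGaussian, charFun_apply, integral_withDensity_eq_integral_toReal_smul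
    (by fun_prop) (by simp)]
  simp_rw [ENNReal.toReal_ofReal (stdGaussianDensity_nonneg _)]
  have h := GaussianFourier.integral_cexp_neg_mul_sq_norm_add (b := ((1 / 2 : ℝ) : ℂ)) (V := E)
    (by norm_num) Complex.I t
  have e : ∀ x : E, stdGaussianDensity E x • Complex.exp ((inner ℝ x t : ℝ) * Complex.I) =
      (((2 * Real.pi) ^ (Module.finrank ℝ E / 2 : ℝ))⁻¹ : ℝ) *
      Complex.exp (-((1 / 2 : ℝ) : ℂ) * ‖x‖ ^ 2 + Complex.I * (inner ℝ t x : ℝ)) := by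
    intro x
    rw [Complex.exp_add, stdGaussianDensity, Complex.real_smul, real_inner_comm]
    push_cast
    rw [mul_comm Complex.I]
    ring
  simp_rw [e]
  rw [integral_const_mul, h]
  have h2 : ((Real.pi : ℂ) / ((1 / 2 : ℝ) : ℂ)) ^ ((Module.finrank ℝ E : ℂ) / 2) =
      (((2 * Real.pi) ^ (Module.finrank ℝ E / 2 : ℝ) : ℝ) : ℂ) := by
    rw [Complex.ofReal_cpow (by positivity)]
    push_cast
    congr 1
    ring
  rw [h2, ← mul_assoc, ← Complex.ofReal_mul, inv_mul_cancel₀ (by positivity)]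
  simp only [Complex.ofReal_one, one_mul, Complex.I_sq]
  congr 1
  push_cast
  ring

lemma lintegral_stdGaussian {f : E → ℝ≥0∞} (hf : Measurable f) :
    ∫⁻ x, f x ∂(stdGaussian E) = ∫⁻ x, ENNReal.ofReal (stdGaussianDensity E x) * f x := by
  rw [stdGaussian_eq_withDensity, lintegral_withDensity_eq_lintegral_mul _ (by fun_prop) hf]
  rfl

/-- The Cameron–Martin formula for the standard Gaussian measure. -/
lemma lintegral_stdGaussian_const_add {f : E → ℝ≥0∞} (hf : Measurable f) (v : E) :
    ∫⁻ x, f (v + x) ∂(stdGaussian E) =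
      ∫⁻ x, f x * ENNReal.ofReal (Real.exp (inner ℝ v x - ‖v‖ ^ 2 / 2)) ∂(stdGaussian E) := by
  rw [lintegral_stdGaussian (by fun_prop), lintegral_stdGaussian (by fun_prop),
    ← lintegral_add_left_eq_self (μ := volume) (fun x ↦ ENNReal.ofReal (stdGaussianDensity E x) *
      (f x * ENNReal.ofReal (Real.exp (inner ℝ v x - ‖v‖ ^ 2 / 2)))) v]
  refine lintegral_congr fun x ↦ ?_
  rw [mul_left_comm, mul_comm, ← ENNReal.ofReal_mul (stdGaussianDensity_nonneg _)]
  congr 2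
  simp only [stdGaussianDensity]
  rw [mul_assoc, ← Real.exp_add]
  congr 2
  rw [norm_add_sq_real, inner_add_right, real_inner_self_eq_norm_sq]
  ring

lemma lintegral_exp_inner_stdGaussian (v : E) :
    ∫⁻ x, ENNReal.ofReal (Real.exp (inner ℝ v x)) ∂(stdGaussian E) =
      ENNReal.ofReal (Real.exp (‖v‖ ^ 2 / 2)) := by
  have h := lintegral_stdGaussian_const_add (E := E) (f := fun _ ↦
    ENNReal.ofReal (Real.exp (‖v‖ ^ 2 / 2))) measurable_const v
  rw [lintegral_const, measure_univ, mul_one] at h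
  rw [h]
  refine lintegral_congr fun x ↦ ?_
  rw [← ENNReal.ofReal_mul (by positivity), ← Real.exp_add]
  congr 2
  ring

/-- Tilting by `exp (‖x‖² / 4)` doubles the variance in every direction, which multiplies the mass
by `√2` per dimension. -/
lemma lintegral_exp_norm_sq_stdGaussian :
    ∫⁻ x : E, ENNReal.ofReal (Real.exp (‖x‖ ^ 2 / 4)) ∂(stdGaussian E) =
      ENNReal.ofReal (2 ^ (Module.finrank ℝ E / 2 : ℝ)) := by
  rw [lintegral_stdGaussian (by fun_prop)]
  have : ∀ x : E, ENNReal.ofReal (stdGaussianDensity E x) *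
      ENNReal.ofReal (Real.exp (‖x‖ ^ 2 / 4)) =
      ENNReal.ofReal (((2 * Real.pi) ^ (Module.finrank ℝ E / 2 : ℝ))⁻¹) *
      ENNReal.ofReal (Real.exp (-(1 / 4) * ‖x‖ ^ 2)) := by
    intro x
    rw [← ENNReal.ofReal_mul (stdGaussianDensity_nonneg _), ← ENNReal.ofReal_mul (by positivity),
      stdGaussianDensity, mul_assoc, ← Real.exp_add]
    congr 3
    ring
  simp_rw [this]
  rw [lintegral_const_mul _ (by fun_prop), lintegral_exp_neg_mul_norm_sq (by norm_num),
    ← ENNReal.ofReal_mul (by positivity), show Real.pi / (1 / 4) = 2 * (2 * Real.pi) by ring,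
    Real.mul_rpow (y := 2 * Real.pi) (by norm_num) (by positivity), mul_left_comm,
    inv_mul_cancel₀ (by positivity), mul_one]

/-- Characteristic functions agree because `⟨P x, t⟩ = ⟨x, t⟩` for `t` in `W`. -/
lemma stdGaussian_map_orthogonalProjectionOnto (W : Submodule ℝ E) :
    (stdGaussian E).map W.orthogonalProjectionOnto = stdGaussian W := by
  have : IsProbabilityMeasure ((stdGaussian E).map W.orthogonalProjectionOnto) :=
    Measure.isProbabilityMeasure_map (by fun_prop)
  apply Measure.ext_of_charFun
  ext t
  rw [charFun_stdGaussian, charFun_apply, integral_map (by fun_prop) (by fun_prop)]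
  have h := charFun_stdGaussian (t : E)
  rw [charFun_apply] at h
  simpa using h

lemma lintegral_exp_norm_sq_orthogonalProjectionOnto (W : Submodule ℝ E) :
    ∫⁻ x : E, ENNReal.ofReal (Real.exp (‖W.orthogonalProjectionOnto x‖ ^ 2 / 4)) ∂(stdGaussian E) =
      ENNReal.ofReal (2 ^ (Module.finrank ℝ W / 2 : ℝ)) := by
  rw [← lintegral_exp_norm_sq_stdGaussian (E := W), ← stdGaussian_map_orthogonalProjectionOnto,
    lintegral_map (by fun_prop) (by fun_prop)]

end Gaussian

open scoped MatrixOrder in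
lemma multivariateGaussian_sq_smul_one {ι : Type*} [Fintype ι] [DecidableEq ι] {σ : ℝ}
    (hσ : 0 < σ) (θ : EuclideanSpace ℝ ι) :
    multivariateGaussian θ (σ ^ 2 • (1 : Matrix ι ι ℝ)) =
      (stdGaussian (EuclideanSpace ℝ ι)).map (fun z ↦ θ + σ • z) := by
  have h : CFC.sqrt (σ ^ 2 • (1 : Matrix ι ι ℝ)) = σ • 1 := by
    apply CFC.sqrt_unique
    · simp [smul_smul, sq]
    · exact (Matrix.PosSemidef.one.smul hσ.le).nonneg
  rw [multivariateGaussian, h]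
  congr 1
  ext x : 1
  simp

lemma risk_eq_lintegral_stdGaussian {n : ℕ} {σ : ℝ} (hσ : 0 < σ)
    {est : EuclideanSpace ℝ (Fin n) → EuclideanSpace ℝ (Fin n)} (hest : Measurable est)
    (θ : EuclideanSpace ℝ (Fin n)) :
    risk n σ est θ = ∫⁻ z, ENNReal.ofReal (‖est (θ + σ • z) - θ‖ ^ 2)
      ∂(stdGaussian (EuclideanSpace ℝ (Fin n))) := by
  rw [risk, multivariateGaussian_sq_smul_one hσ, lintegral_map (by fun_prop) (by fun_prop)]

/-! ### Least squares over a finite union of subspaces. -/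

section LeastSquares

variable {E : Type*} [NormedAddCommGroup E] [InnerProductSpace ℝ E] [FiniteDimensional ℝ E]
  [MeasurableSpace E] [BorelSpace E]

/-- Induction on `s`: the current best fit is compared with one more orthogonal projection, and the
choice depends on a measurable condition. -/
lemma exists_measurable_leastSquares_finset {ι : Type*} (V : ι → Submodule ℝ E) {s : Finset ι}
    (hs : s.Nonempty) :
    ∃ est : E → E, Measurable est ∧ (∀ x, ∃ i, est x ∈ V i) ∧
      ∀ x, ∀ i ∈ s, ∀ v ∈ V i, ‖x - est x‖ ≤ ‖x - v‖ := by
  have hproj (i : ι) (x v : E) (hv : v ∈ V i) : ‖x - (V i).starProjection x‖ ≤ ‖x - v‖ := by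
    rw [Submodule.starProjection_minimal]
    exact ciInf_le (f := fun w : V i ↦ ‖x - w‖) ⟨0, by rintro _ ⟨w, rfl⟩; positivity⟩ ⟨v, hv⟩
  induction hs using Finset.Nonempty.cons_induction with
  | singleton a =>
    refine ⟨(V a).starProjection, by fun_prop, fun x ↦ ⟨a, by simp⟩, fun x i hi v hv ↦ ?_⟩
    rw [Finset.mem_singleton] at hi
    subst hi
    exact hproj i x v hv
  | cons a s h hs ih =>
    obtain ⟨e, hm, hmem, hmin⟩ := ih
    classical
    refine ⟨fun x ↦ if ‖x - e x‖ ≤ ‖x - (V a).starProjection x‖ then e x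
      else (V a).starProjection x, ?_, fun x ↦ ?_, fun x i hi v hv ↦ ?_⟩
    · exact Measurable.ite (measurableSet_le (by fun_prop) (by fun_prop)) hm (by fun_prop)
    · dsimp only
      split_ifs
      exacts [hmem x, ⟨a, by simp⟩]
    · dsimp only
      rw [Finset.mem_cons] at hi
      split_ifs with hle
      · rcases hi with rfl | hi
        exacts [hle.trans (hproj i x v hv), hmin x i hi v hv]
      · rcases hi with rfl | hi
        exacts [hproj i x v hv, (not_le.1 hle).le.trans (hmin x i hi v hv)]

/-- The basic inequality `‖u‖² ≤ 2σ⟨z, u⟩` is squared and divided by `‖u‖²`. The `max 0` covers `u =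
0`, where nothing forces `G` to be nonnegative. -/
lemma norm_sub_sq_le_of_leastSquares {θ z w : E} {σ G : ℝ}
    (hmin : ‖θ + σ • z - w‖ ≤ ‖θ + σ • z - θ‖)
    (hG : inner ℝ z (w - θ) ^ 2 ≤ G * ‖w - θ‖ ^ 2) :
    ‖w - θ‖ ^ 2 ≤ max 0 (4 * σ ^ 2 * G) := by
  rw [show θ + σ • z - w = σ • z - (w - θ) by abel, show θ + σ • z - θ = σ • z by abel] at hmin
  generalize w - θ = u at *
  have h1 : ‖u‖ ^ 2 ≤ 2 * σ * inner ℝ z u := by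
    have := pow_le_pow_left₀ (norm_nonneg _) hmin 2
    rw [norm_sub_sq_real, inner_smul_left] at this
    simp only [conj_trivial] at this
    linarith
  rcases eq_or_ne u 0 with rfl | hu
  · simp
  have hu' : 0 < ‖u‖ ^ 2 := by positivity
  refine le_max_of_le_right (le_of_mul_le_mul_right ?_ hu')
  calc ‖u‖ ^ 2 * ‖u‖ ^ 2 ≤ (2 * σ * inner ℝ z u) * (2 * σ * inner ℝ z u) :=
        mul_self_le_mul_self hu'.le h1
    _ = 4 * σ ^ 2 * inner ℝ z u ^ 2 := by ring
    _ ≤ 4 * σ ^ 2 * (G * ‖u‖ ^ 2) := by gcongr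
    _ = _ := by ring

end LeastSquares

/-- Oracle bound for least squares over a finite union of subspaces. -/
lemma minimaxRisk_le_of_forall_inner_sq_le {n : ℕ} {σ : ℝ} (hσ : 0 < σ)
    {T : Set (EuclideanSpace ℝ (Fin n))} {ι : Type*} [Fintype ι] [Nonempty ι]
    (V : ι → Submodule ℝ (EuclideanSpace ℝ (Fin n))) {B : ℝ}
    (h : ∀ θ ∈ T, (∃ i, θ ∈ V i) ∧ ∃ G : EuclideanSpace ℝ (Fin n) → ℝ,
      (∀ z, ∀ i, ∀ v ∈ V i, inner ℝ z (v - θ) ^ 2 ≤ G z * ‖v - θ‖ ^ 2) ∧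
      ∫⁻ z, ENNReal.ofReal (G z) ∂(stdGaussian (EuclideanSpace ℝ (Fin n))) ≤ ENNReal.ofReal B) :
    minimaxRisk n σ T ≤ ENNReal.ofReal (4 * σ ^ 2 * B) := by
  obtain ⟨est, hm, hmem, hmin⟩ := exists_measurable_leastSquares_finset V
    (Finset.univ_nonempty (α := ι))
  refine (iInf₂_le est hm).trans (iSup₂_le fun θ hθ ↦ ?_)
  obtain ⟨⟨j, hj⟩, G, hG, hint⟩ := h θ hθ
  rw [risk_eq_lintegral_stdGaussian hσ hm]
  calc ∫⁻ z, ENNReal.ofReal (‖est (θ + σ • z) - θ‖ ^ 2) ∂(stdGaussian _)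
      ≤ ∫⁻ z, ENNReal.ofReal (4 * σ ^ 2) * ENNReal.ofReal (G z) ∂(stdGaussian _) := by
        refine lintegral_mono fun z ↦ ?_
        obtain ⟨i, hi⟩ := hmem (θ + σ • z)
        have := norm_sub_sq_le_of_leastSquares
          (hmin (θ + σ • z) j (Finset.mem_univ j) θ hj) (hG z i _ hi)
        rw [← ENNReal.ofReal_mul (by positivity)]
        refine (ENNReal.ofReal_le_ofReal this).trans ?_
        rw [ENNReal.ofReal_max]
        simp
    _ = ENNReal.ofReal (4 * σ ^ 2) *
          ∫⁻ z, ENNReal.ofReal (G z) ∂(stdGaussian (EuclideanSpace ℝ (Fin n))) :=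
        lintegral_const_mul' _ _ ENNReal.ofReal_ne_top
    _ ≤ ENNReal.ofReal (4 * σ ^ 2) * ENNReal.ofReal B := by gcongr
    _ = _ := (ENNReal.ofReal_mul (by positivity)).symm

/-- A tangent line to the logarithm at `A`. Used pointwise with `A` bounding the mean of `exp t`, it
replaces Jensen's inequality at the price of an additive `1`. -/
lemma le_log_add_exp_div (t : ℝ) {A : ℝ} (hA : 0 < A) : t ≤ Real.log A + Real.exp t / A := by
  have := Real.add_one_le_exp (t - Real.log A)
  rw [Real.exp_sub, Real.exp_log hA] at this
  linarith

lemma lintegral_log_add_div_le {Ω : Type*} [MeasurableSpace Ω] {μ : Measure Ω}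
    [IsProbabilityMeasure μ] {F : Ω → ℝ} {A : ℝ} (hA : 1 ≤ A)
    (h : ∫⁻ ω, ENNReal.ofReal (F ω) ∂μ ≤ ENNReal.ofReal A) {b : ℝ} (hb : 0 ≤ b) :
    ∫⁻ ω, ENNReal.ofReal (b * (Real.log A + F ω / A)) ∂μ ≤
      ENNReal.ofReal (b * (Real.log A + 1)) := by
  have hA0 : 0 < A := by linarith
  have hl := Real.log_nonneg hA
  calc ∫⁻ ω, ENNReal.ofReal (b * (Real.log A + F ω / A)) ∂μ
      ≤ ∫⁻ ω, (ENNReal.ofReal (b * Real.log A) + ENNReal.ofReal (b / A) * ENNReal.ofReal (F ω)) ∂μ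
        := by
        refine lintegral_mono fun ω ↦ ?_
        dsimp only
        rw [← ENNReal.ofReal_mul (by positivity), mul_add, mul_div_left_comm, mul_comm (F ω)]
        exact ENNReal.ofReal_add_le
    _ = ENNReal.ofReal (b * Real.log A) + ENNReal.ofReal (b / A) * ∫⁻ ω, ENNReal.ofReal (F ω) ∂μ
        := by
        rw [lintegral_add_left (by fun_prop), lintegral_const, measure_univ, mul_one,
          lintegral_const_mul' _ _ (by simp)]
    _ ≤ ENNReal.ofReal (b * Real.log A) + ENNReal.ofReal (b / A) * ENNReal.ofReal A := by gcongr
    _ = _ := by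
        rw [← ENNReal.ofReal_mul (by positivity), ← ENNReal.ofReal_add (by positivity)
          (by positivity), div_mul_cancel₀ _ hA0.ne', mul_add, mul_one]

lemma minimaxRisk_le_of_subset_iUnion_submodule {n : ℕ} {σ : ℝ} (hσ : 0 < σ)
    {T : Set (EuclideanSpace ℝ (Fin n))} {ι : Type*} [Fintype ι] [Nonempty ι]
    (V : ι → Submodule ℝ (EuclideanSpace ℝ (Fin n))) (hT : ∀ θ ∈ T, ∃ i, θ ∈ V i)
    {d : ℕ} (hd : ∀ i, Module.finrank ℝ (V i) ≤ d) :
    minimaxRisk n σ T ≤ ENNReal.ofReal (4 * σ ^ 2 *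
      (4 * (Real.log (Fintype.card ι) + ((d + 1 : ℕ) / 2 : ℝ) * Real.log 2 + 1))) := by
  refine minimaxRisk_le_of_forall_inner_sq_le hσ V fun θ hθ ↦ ⟨hT θ hθ, ?_⟩
  -- Adjoining `θ` makes `v - θ` an element of `W i` for every `v ∈ V i`, at the cost of one
  -- dimension.
  set W : ι → Submodule ℝ (EuclideanSpace ℝ (Fin n)) := fun i ↦ V i ⊔ Submodule.span ℝ {θ}
  have hW (i : ι) : Module.finrank ℝ (W i) ≤ d + 1 := by
    refine (Submodule.finrank_add_le_finrank_add_finrank _ _).trans (add_le_add (hd i) ?_)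
    simpa using finrank_span_le_card (R := ℝ) ({θ} : Set (EuclideanSpace ℝ (Fin n)))
  have hcard : (1 : ℝ) ≤ Fintype.card ι := by exact_mod_cast Fintype.card_pos
  have h2 : (1 : ℝ) ≤ 2 ^ ((d + 1 : ℕ) / 2 : ℝ) := Real.one_le_rpow (by norm_num) (by positivity)
  set A : ℝ := Fintype.card ι * 2 ^ ((d + 1 : ℕ) / 2 : ℝ)
  have hA : 1 ≤ A := one_le_mul_of_one_le_of_one_le hcard h2
  have hlogA : Real.log A = Real.log (Fintype.card ι) + ((d + 1 : ℕ) / 2 : ℝ) * Real.log 2 := by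
    rw [Real.log_mul (by positivity) (by positivity), Real.log_rpow (by norm_num)]
  -- The sum over `i` dominates each exponential, hence their maximum, and `A` bounds its mean.
  refine ⟨fun z ↦ 4 * (Real.log A +
    (∑ i, Real.exp (‖(W i).orthogonalProjectionOnto z‖ ^ 2 / 4)) / A), fun z i v hv ↦ ?_, ?_⟩
  · have hmem : v - θ ∈ W i := sub_mem (Submodule.mem_sup_left hv)
      (Submodule.mem_sup_right (Submodule.mem_span_singleton_self θ))
    have hin : inner ℝ z (v - θ) = inner ℝ ((W i).orthogonalProjectionOnto z) ⟨v - θ, hmem⟩ := by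
      simp
    have h1 : inner ℝ z (v - θ) ^ 2 ≤ ‖(W i).orthogonalProjectionOnto z‖ ^ 2 * ‖v - θ‖ ^ 2 := by
      rw [hin, ← mul_pow, ← sq_abs]
      gcongr
      exact abs_real_inner_le_norm _ _
    refine h1.trans ?_
    gcongr
    have h3 := le_log_add_exp_div (‖(W i).orthogonalProjectionOnto z‖ ^ 2 / 4)
      (show 0 < A by linarith)
    have h4 : Real.exp (‖(W i).orthogonalProjectionOnto z‖ ^ 2 / 4) ≤
        ∑ i, Real.exp (‖(W i).orthogonalProjectionOnto z‖ ^ 2 / 4) :=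
      Finset.single_le_sum (f := fun i ↦ Real.exp (‖(W i).orthogonalProjectionOnto z‖ ^ 2 / 4))
        (fun _ _ ↦ (Real.exp_pos _).le) (Finset.mem_univ i)
    have h5 := div_le_div_of_nonneg_right h4 (show 0 ≤ A by linarith)
    linarith
  · rw [← hlogA]
    refine lintegral_log_add_div_le hA ?_ (by norm_num)
    simp_rw [ENNReal.ofReal_sum_of_nonneg (fun _ _ ↦ (Real.exp_pos _).le)]
    rw [lintegral_finsetSum _ (by fun_prop)]
    simp_rw [lintegral_exp_norm_sq_orthogonalProjectionOnto]
    calc ∑ i, ENNReal.ofReal (2 ^ (Module.finrank ℝ (W i) / 2 : ℝ))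
        ≤ ∑ _i : ι, ENNReal.ofReal (2 ^ ((d + 1 : ℕ) / 2 : ℝ)) := by
          refine Finset.sum_le_sum fun i _ ↦ ENNReal.ofReal_le_ofReal ?_
          gcongr
          · norm_num
          · exact hW i
      _ = ENNReal.ofReal A := by
          rw [Finset.sum_const, Finset.card_univ, nsmul_eq_mul,
            ENNReal.ofReal_mul (by positivity), ENNReal.ofReal_natCast]

/-! ### Combinatorial structure of `Θ_k`. -/

section Membership

variable {n k : ℕ}

lemma exists_mem_Ioc_of_monotone {a : Fin (k + 1) → ℕ} (h0 : a 0 = 0) (hl : a (Fin.last k) = n)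
    (i : Fin n) : ∃ j : Fin k, (i : ℕ) + 1 ∈ Set.Ioc (a j.castSucc) (a j.succ) := by
  by_contra! h
  have : ∀ j : Fin (k + 1), a j ≤ i := by
    intro j
    induction j using Fin.induction with
    | zero => omega
    | succ j ih =>
      have := h j
      rw [Set.mem_Ioc] at this
      omega
  have := this (Fin.last k)
  have := i.2
  omega

/-- A vector whose pieces are the level sets of a monotone labelling with labels `< k`. -/
lemma mem_Theta_of_monotone {θ : EuclideanSpace ℝ (Fin n)} {c : ℕ → ℕ} (hc : Monotone c)
    (hck : ∀ i < n, c i < k) (μ : ℕ → ℝ) (hθ : ∀ i : Fin n, θ i = μ (c i)) : θ ∈ Theta n k := by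
  -- The sets `{c < j}` are initial segments, so their cardinalities serve as the cut points; an
  -- unused label gives an empty piece.
  have key (j i : ℕ) (hi : i < n) : i < ((Finset.range n).filter (fun i ↦ c i < j)).card ↔
      c i < j := by
    constructor
    · intro h
      by_contra hij
      have hsub : (Finset.range n).filter (fun i ↦ c i < j) ⊆ Finset.range i := by
        intro l hl
        rw [Finset.mem_filter] at hl
        rw [Finset.mem_range]
        by_contra hli
        exact hij ((hc (not_lt.1 hli)).trans_lt hl.2)
      have := Finset.card_le_card hsub
      rw [Finset.card_range] at this
      omega
    · intro h
      have hsub : Finset.range (i + 1) ⊆ (Finset.range n).filter (fun i ↦ c i < j) := by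
        intro l hl
        rw [Finset.mem_range] at hl
        rw [Finset.mem_filter, Finset.mem_range]
        exact ⟨by omega, (hc (by omega)).trans_lt h⟩
      have := Finset.card_le_card hsub
      rw [Finset.card_range] at this
      omega
  refine ⟨fun j ↦ ((Finset.range n).filter (fun i ↦ c i < j)).card, fun j ↦ μ j, by simp, ?_, ?_, ?_⟩
  · intro j j' hj
    refine Finset.card_le_card (Finset.monotone_filter_right _ fun i _ hi ↦ ?_)
    exact lt_of_lt_of_le hi hj
  · simp only [Fin.val_last]
    rw [Finset.filter_true_of_mem (fun i hi ↦ hck i (Finset.mem_range.1 hi)), Finset.card_range]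
  · intro j i hi
    rw [hθ]
    have h1 := key (j : ℕ) i i.2
    have h2 := key ((j : ℕ) + 1) i i.2
    simp only [Set.mem_Ioc, Fin.val_castSucc, Fin.val_succ] at hi
    congr 1
    have h3 : c i < j + 1 := h2.1 (by omega)
    have h4 : ¬ c i < j := fun h ↦ by have := h1.2 h; omega
    omega

lemma Theta_one_apply {θ : EuclideanSpace ℝ (Fin n)} (h : θ ∈ Theta n 1) :
    ∃ t : ℝ, ∀ i, θ i = t := by
  obtain ⟨a, μ, h0, -, hl, h⟩ := h
  refine ⟨μ 0, fun i ↦ ?_⟩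
  obtain ⟨j, hj⟩ := exists_mem_Ioc_of_monotone h0 hl i
  rw [h j i hj, Subsingleton.elim j 0]

lemma Theta_two_apply {θ : EuclideanSpace ℝ (Fin n)} (h : θ ∈ Theta n 2) :
    ∃ m ≤ n, ∃ s t : ℝ, ∀ i : Fin n, θ i = if (i : ℕ) < m then s else t := by
  obtain ⟨a, μ, h0, hm, hl, h⟩ := h
  refine ⟨a 1, hl ▸ hm (Fin.le_last _), μ 0, μ 1, fun i ↦ ?_⟩
  have hl' : a 2 = n := hl
  split_ifs with hi
  · refine h 0 i ?_
    simpa [h0] using hi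
  · refine h 1 i ?_
    have h1 : a (Fin.castSucc (1 : Fin 2)) = a 1 := rfl
    have h2 : a (Fin.succ (1 : Fin 2)) = a 2 := rfl
    rw [Set.mem_Ioc, h1, h2]
    have := i.2
    omega

/-- The space of vectors that jump only at the positions in `T`. -/
def jumpSpace (n : ℕ) (T : Finset (Fin n)) : Submodule ℝ (EuclideanSpace ℝ (Fin n)) where
  carrier := {v | ∀ i j : Fin n, (j : ℕ) = i + 1 → j ∉ T → v j = v i}
  add_mem' hv hw i j hij hj := by simp [hv i j hij hj, hw i j hij hj]
  zero_mem' := by simp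
  smul_mem' c v hv i j hij hj := by simp [hv i j hij hj]

lemma mem_jumpSpace {T : Finset (Fin n)} {v : EuclideanSpace ℝ (Fin n)} :
    v ∈ jumpSpace n T ↔ ∀ i j : Fin n, (j : ℕ) = i + 1 → j ∉ T → v j = v i := Iff.rfl

/-- Evaluation at coordinate `0` and at the jump positions is injective. -/
lemma finrank_jumpSpace_le (T : Finset (Fin n)) :
    Module.finrank ℝ (jumpSpace n T) ≤ T.card + 1 := by
  rcases Nat.eq_zero_or_pos n with rfl | hn
  · exact (Submodule.finrank_le _).trans (by simp)
  let S : Finset (Fin n) := insert ⟨0, hn⟩ T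
  let f : jumpSpace n T →ₗ[ℝ] (S → ℝ) :=
    { toFun := fun v i ↦ (v : EuclideanSpace ℝ (Fin n)) i
      map_add' := fun v w ↦ by ext; simp
      map_smul' := fun c v ↦ by ext; simp }
  have hf : Function.Injective f := by
    rw [← LinearMap.ker_eq_bot, LinearMap.ker_eq_bot']
    rintro ⟨v, hv⟩ h
    have hS : ∀ i ∈ S, v i = 0 := fun i hi ↦ congrFun h ⟨i, hi⟩
    have : ∀ m : ℕ, ∀ hm : m < n, v ⟨m, hm⟩ = 0 := by
      intro m
      induction m with
      | zero => intro hm; exact hS _ (Finset.mem_insert_self _ _)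
      | succ m ih =>
        intro hm
        by_cases hT : (⟨m + 1, hm⟩ : Fin n) ∈ T
        · exact hS _ (Finset.mem_insert_of_mem hT)
        · rw [hv ⟨m, by omega⟩ ⟨m + 1, hm⟩ rfl hT, ih]
    ext i
    exact this i i.2
  refine (LinearMap.finrank_le_finrank_of_injective hf).trans ?_
  rw [Module.finrank_fintype_fun_eq_card, Fintype.card_coe]
  exact Finset.card_insert_le _ _

lemma exists_mem_jumpSpace {θ : EuclideanSpace ℝ (Fin n)} (h : θ ∈ Theta n k) :
    ∃ T : Finset (Fin n), T.card ≤ k ∧ θ ∈ jumpSpace n T := by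
  obtain ⟨a, μ, h0, -, hl, h⟩ := h
  classical
  -- With 0-based indices a piece starts at the index equal to its left cut point. The cut `a 0 = 0`
  -- is included, so the bound is `k` and not `k - 1`, which only affects constants.
  let T : Finset (Fin n) := Finset.univ.filter fun i ↦ ∃ j : Fin k, a j.castSucc = i
  refine ⟨T, ?_, ?_⟩
  · calc T.card = (T.map Fin.valEmbedding).card := (Finset.card_map _).symm
      _ ≤ (Finset.univ.image fun j : Fin k ↦ a j.castSucc).card := by
        refine Finset.card_le_card fun l hl ↦ ?_
        simp only [T, Finset.mem_map, Finset.mem_filter, Finset.mem_univ, true_and,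
          Fin.valEmbedding_apply] at hl
        obtain ⟨i, ⟨j, hj⟩, rfl⟩ := hl
        exact Finset.mem_image.2 ⟨j, Finset.mem_univ _, hj⟩
      _ ≤ k := Finset.card_image_le.trans (by simp)
  · rw [mem_jumpSpace]
    intro i i' hi hT
    obtain ⟨j, hj⟩ := exists_mem_Ioc_of_monotone h0 hl i'
    have hne : a j.castSucc ≠ i' := fun hne ↦ hT (by simpa [T] using ⟨j, hne⟩)
    rw [h j i' hj, h j i]
    rw [Set.mem_Ioc] at hj ⊢
    omega

/-- Weight each `T` by `(k/n)^|T| ≥ (k/n)^k`; over all subsets the weights sum to `(1 + k/n)^n ≤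
e^k`. -/
lemma card_finset_card_le_mul_pow (hk : 1 ≤ k) (hkn : k ≤ n) :
    (Fintype.card {T : Finset (Fin n) // T.card ≤ k} : ℝ) ≤ (Real.exp 1 * n / k) ^ k := by
  have hk0 : (0 : ℝ) < k := by exact_mod_cast hk
  have hn0 : (0 : ℝ) < n := by exact_mod_cast (hk.trans hkn)
  have hx : (k : ℝ) / n ≤ 1 := by rw [div_le_one hn0]; exact_mod_cast hkn
  have hx0 : 0 < (k : ℝ) / n := by positivity
  have h1 : (Fintype.card {T : Finset (Fin n) // T.card ≤ k} : ℝ) * (k / n : ℝ) ^ k ≤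
      ∑ T : Finset (Fin n), (k / n : ℝ) ^ T.card := by
    rw [Fintype.card_subtype, ← nsmul_eq_mul, ← Finset.sum_const]
    refine (Finset.sum_le_sum fun T hT ↦ ?_).trans
      (Finset.sum_le_sum_of_subset_of_nonneg (Finset.filter_subset _ _) fun _ _ _ ↦ by positivity)
    exact pow_le_pow_of_le_one hx0.le hx (Finset.mem_filter.1 hT).2
  have h2 : ∑ T : Finset (Fin n), (k / n : ℝ) ^ T.card = (k / n + 1 : ℝ) ^ n := by
    have := Finset.sum_pow_mul_eq_add_pow (k / n : ℝ) 1 (Finset.univ : Finset (Fin n))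
    simpa using this
  have h3 : (k / n + 1 : ℝ) ^ n ≤ Real.exp 1 ^ k := by
    calc (k / n + 1 : ℝ) ^ n ≤ Real.exp (k / n) ^ n := by
          gcongr
          exact Real.add_one_le_exp _
      _ = Real.exp 1 ^ k := by
          rw [← Real.exp_nat_mul, ← Real.exp_nat_mul]
          congr 1
          field_simp
  have h4 : (Real.exp 1 * n / k) ^ k = Real.exp 1 ^ k / (k / n : ℝ) ^ k := by
    rw [← div_pow]
    congr 1
    field_simp
  rw [h4, le_div_iff₀ (by positivity)]
  linarith

end Membership

/-! ### Upper bounds by counting subspaces. -/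

lemma minimaxRisk_Theta_one_le {n : ℕ} {σ : ℝ} (hσ : 0 < σ) :
    minimaxRisk n σ (Theta n 1) ≤ ENNReal.ofReal (32 * σ ^ 2) := by
  let V : Unit → Submodule ℝ (EuclideanSpace ℝ (Fin n)) :=
    fun _ ↦ Submodule.span ℝ {WithLp.toLp 2 fun _ ↦ (1 : ℝ)}
  refine (minimaxRisk_le_of_subset_iUnion_submodule hσ V (d := 1) (fun θ hθ ↦ ⟨(), ?_⟩)
    fun _ ↦ ?_).trans (ENNReal.ofReal_le_ofReal ?_)
  · obtain ⟨t, ht⟩ := Theta_one_apply hθ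
    refine Submodule.mem_span_singleton.2 ⟨t, ?_⟩
    ext i
    simp [ht]
  · simpa using finrank_span_le_card (R := ℝ)
      ({WithLp.toLp 2 fun _ ↦ (1 : ℝ)} : Set (EuclideanSpace ℝ (Fin n)))
  · have := Real.log_two_lt_d9
    have h : 0 < σ ^ 2 := by positivity
    simp only [Fintype.card_unit, Nat.cast_one, Real.log_one]
    norm_num
    nlinarith

lemma one_le_log_exp_mul_div {n k : ℕ} (hk : 1 ≤ k) (hkn : k ≤ n) :
    1 ≤ Real.log (Real.exp 1 * n / k) := by
  have hk0 : (0 : ℝ) < k := by exact_mod_cast hk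
  have : (k : ℝ) ≤ n := by exact_mod_cast hkn
  have hn0 : (0 : ℝ) < n := hk0.trans_le this
  rw [Real.le_log_iff_exp_le (by positivity), le_div_iff₀ hk0]
  gcongr

lemma minimaxRisk_Theta_le {n k : ℕ} {σ : ℝ} (hσ : 0 < σ) (hk : 2 ≤ k) (hkn : k ≤ n) :
    minimaxRisk n σ (Theta n k) ≤
      ENNReal.ofReal (48 * (σ ^ 2 * k * Real.log (Real.exp 1 * n / k))) := by
  have : Nonempty {T : Finset (Fin n) // T.card ≤ k} := ⟨∅, by simp⟩
  refine (minimaxRisk_le_of_subset_iUnion_submodule hσ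
    (fun T : {T : Finset (Fin n) // T.card ≤ k} ↦ jumpSpace n T) (d := k + 1) (fun θ hθ ↦ ?_)
    fun T ↦ (finrank_jumpSpace_le _).trans (by have := T.2; omega)).trans
    (ENNReal.ofReal_le_ofReal ?_)
  · obtain ⟨T, hT, h⟩ := exists_mem_jumpSpace hθ
    exact ⟨⟨T, hT⟩, h⟩
  · have h1 := card_finset_card_le_mul_pow (by omega : 1 ≤ k) hkn
    have hcard : (0 : ℝ) < Fintype.card {T : Finset (Fin n) // T.card ≤ k} := by
      exact_mod_cast Fintype.card_pos
    have h2 := Real.log_le_log hcard h1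
    rw [Real.log_pow] at h2
    have hL := one_le_log_exp_mul_div (by omega : 1 ≤ k) hkn
    set l := Real.log (Real.exp 1 * n / k)
    have hk' : (2 : ℝ) ≤ k := by exact_mod_cast hk
    have h3 : ((k + 1 + 1 : ℕ) / 2 : ℝ) * Real.log 2 ≤ k * l := by
      have : ((k + 1 + 1 : ℕ) / 2 : ℝ) ≤ k := by push_cast; linarith
      have h2 : Real.log 2 ≤ l := by have := Real.log_two_lt_d9; linarith
      have : 0 < Real.log 2 := Real.log_pos one_lt_two
      gcongr
    have h4 : (1 : ℝ) ≤ k * l := by nlinarith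
    calc _ ≤ 4 * σ ^ 2 * (4 * (k * l + k * l + k * l)) := by gcongr
      _ = _ := by ring

/-! ### Testing a Gaussian against a mixture of its translates. -/

section TwoHypotheses

variable {E : Type*} [NormedAddCommGroup E] [InnerProductSpace ℝ E] [FiniteDimensional ℝ E]
  [MeasurableSpace E] [BorelSpace E] {J : Type*} [Fintype J]

lemma lintegral_sq_sum_exp_inner_stdGaussian (v : J → E) :
    ∫⁻ z, ENNReal.ofReal ((∑ j, Real.exp (inner ℝ (v j) z - ‖v j‖ ^ 2 / 2)) ^ 2)
      ∂(stdGaussian E) = ENNReal.ofReal (∑ j, ∑ l, Real.exp (inner ℝ (v j) (v l))) := by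
  have h (z : E) : ENNReal.ofReal ((∑ j, Real.exp (inner ℝ (v j) z - ‖v j‖ ^ 2 / 2)) ^ 2) =
      ∑ j, ∑ l, ENNReal.ofReal (Real.exp (-(‖v j‖ ^ 2 + ‖v l‖ ^ 2) / 2)) *
        ENNReal.ofReal (Real.exp (inner ℝ (v j + v l) z)) := by
    rw [sq, Finset.sum_mul_sum,
      ENNReal.ofReal_sum_of_nonneg (fun _ _ ↦ Finset.sum_nonneg fun _ _ ↦ by positivity)]
    refine Finset.sum_congr rfl fun j _ ↦ ?_
    rw [ENNReal.ofReal_sum_of_nonneg (fun _ _ ↦ by positivity)]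
    refine Finset.sum_congr rfl fun l _ ↦ ?_
    rw [← ENNReal.ofReal_mul (by positivity), ← Real.exp_add, ← Real.exp_add, inner_add_left]
    congr 2
    ring
  simp_rw [h]
  rw [lintegral_finsetSum _ (by fun_prop),
    ENNReal.ofReal_sum_of_nonneg (fun _ _ ↦ Finset.sum_nonneg fun _ _ ↦ by positivity)]
  refine Finset.sum_congr rfl fun j _ ↦ ?_
  rw [lintegral_finsetSum _ (by fun_prop), ENNReal.ofReal_sum_of_nonneg (fun _ _ ↦ by positivity)]
  refine Finset.sum_congr rfl fun l _ ↦ ?_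
  rw [lintegral_const_mul _ (by fun_prop), lintegral_exp_inner_stdGaussian,
    ← ENNReal.ofReal_mul (by positivity), ← Real.exp_add, norm_add_sq_real]
  congr 2
  ring

/-- A Gaussian and a uniform mixture of its translates with bounded `χ²`-divergence cannot be
separated by a test. -/
lemma sum_measure_const_add_preimage_le (v : J → E)
    (hv : ∑ j, ∑ l, Real.exp (inner ℝ (v j) (v l)) ≤ 2 * (Fintype.card J : ℝ) ^ 2)
    {A : Set E} (hA : MeasurableSet A) :
    ∑ j, stdGaussian E ((v j + ·) ⁻¹' A) ≤
      ENNReal.ofReal (Fintype.card J / 2) + Fintype.card J * stdGaussian E A := by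
  rcases isEmpty_or_nonempty J with hJ | hJ
  · simp
  have hN : (0 : ℝ) < Fintype.card J := by exact_mod_cast Fintype.card_pos
  set N : ℝ := (Fintype.card J : ℝ) with hNdef
  have hmeas : Measurable (A.indicator (1 : E → ℝ≥0∞)) := measurable_one.indicator hA
  have h1 (j : J) : stdGaussian E ((v j + ·) ⁻¹' A) =
      ∫⁻ z, A.indicator 1 z * ENNReal.ofReal (Real.exp (inner ℝ (v j) z - ‖v j‖ ^ 2 / 2))
        ∂(stdGaussian E) := by
    rw [← lintegral_stdGaussian_const_add hmeas, ← lintegral_indicator_one (by measurability)]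
    rfl
  simp_rw [h1]
  rw [← lintegral_finsetSum _ (by fun_prop)]
  calc ∫⁻ z, ∑ j, A.indicator 1 z * ENNReal.ofReal (Real.exp (inner ℝ (v j) z - ‖v j‖ ^ 2 / 2))
        ∂(stdGaussian E)
      ≤ ∫⁻ z, (ENNReal.ofReal (1 / (4 * N)) * ENNReal.ofReal
          ((∑ j, Real.exp (inner ℝ (v j) z - ‖v j‖ ^ 2 / 2)) ^ 2) +
          ENNReal.ofReal N * A.indicator 1 z) ∂(stdGaussian E) := by
        refine lintegral_mono fun z ↦ ?_
        dsimp only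
        rw [← Finset.mul_sum, ← ENNReal.ofReal_sum_of_nonneg (fun _ _ ↦ by positivity)]
        set S := ∑ j, Real.exp (inner ℝ (v j) z - ‖v j‖ ^ 2 / 2)
        by_cases hz : z ∈ A
        · simp only [Set.indicator_of_mem hz, Pi.one_apply, one_mul, mul_one]
          rw [← ENNReal.ofReal_mul (by positivity), ← ENNReal.ofReal_add (by positivity) hN.le]
          refine ENNReal.ofReal_le_ofReal ?_
          -- AM–GM in the form `S ≤ S² / (4N) + N`; a second moment at most `2N²` turns the first
          -- term into `N / 2`.
          rw [← sub_nonneg, show 1 / (4 * N) * S ^ 2 + N - S = (S - 2 * N) ^ 2 / (4 * N) by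
            field_simp; ring]
          positivity
        · simp [Set.indicator_of_notMem hz]
    _ = ENNReal.ofReal (1 / (4 * N)) *
          ENNReal.ofReal (∑ j, ∑ l, Real.exp (inner ℝ (v j) (v l))) +
          ENNReal.ofReal N * stdGaussian E A := by
        rw [lintegral_add_left (by fun_prop), lintegral_const_mul _ (by fun_prop),
          lintegral_const_mul _ hmeas, lintegral_sq_sum_exp_inner_stdGaussian,
          lintegral_indicator_one hA]
    _ ≤ _ := by
        rw [← ENNReal.ofReal_mul (by positivity), hNdef, ENNReal.ofReal_natCast, ← hNdef]
        gcongr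
        calc 1 / (4 * N) * ∑ j, ∑ l, Real.exp (inner ℝ (v j) (v l)) ≤ 1 / (4 * N) * (2 * N ^ 2) := by
              gcongr
          _ = N / 2 := by field_simp; ring

/-- Passing to complements: the two error probabilities of any test, averaged over `j`, add up to at
least `1/2`. -/
lemma le_add_measure_of_chiSq (v : J → E)
    (hv : ∑ j, ∑ l, Real.exp (inner ℝ (v j) (v l)) ≤ 2 * (Fintype.card J : ℝ) ^ 2)
    {A : Set E} (hA : MeasurableSet A) :
    ENNReal.ofReal (Fintype.card J / 2) ≤ Fintype.card J * stdGaussian E A +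
      ∑ j, stdGaussian E ((v j + ·) ⁻¹' Aᶜ) := by
  have h := sum_measure_const_add_preimage_le v hv hA
  have h2 : (Fintype.card J : ℝ≥0∞) = ∑ j, stdGaussian E ((v j + ·) ⁻¹' A) +
      ∑ j, stdGaussian E ((v j + ·) ⁻¹' Aᶜ) := by
    rw [← Finset.sum_add_distrib]
    simp_rw [Set.preimage_compl]
    rw [Finset.sum_congr rfl fun j _ ↦ prob_add_prob_compl (μ := stdGaussian E)
      (measurable_const_add (v j) hA)]
    simp
  have h3 : (Fintype.card J : ℝ≥0∞) = ENNReal.ofReal (Fintype.card J / 2) +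
      ENNReal.ofReal (Fintype.card J / 2) := by
    rw [← ENNReal.ofReal_add (by positivity) (by positivity), add_halves, ENNReal.ofReal_natCast]
  have h4 : ENNReal.ofReal (Fintype.card J / 2) + ENNReal.ofReal (Fintype.card J / 2) ≤
      ENNReal.ofReal (Fintype.card J / 2) + (Fintype.card J * stdGaussian E A +
      ∑ j, stdGaussian E ((v j + ·) ⁻¹' Aᶜ)) := by
    rw [← h3, ← add_assoc]
    conv_lhs => rw [h2]
    gcongr
  exact (ENNReal.add_le_add_iff_left ENNReal.ofReal_ne_top).1 h4

/-- Bayes risk bound for the uniform prior on the translates `v j` against the null. -/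
lemma le_lintegral_norm_sq_add_sum (v w : J → E)
    (hv : ∑ j, ∑ l, Real.exp (inner ℝ (v j) (v l)) ≤ 2 * (Fintype.card J : ℝ) ^ 2)
    {r : ℝ} (hr : 0 ≤ r) (hw : ∀ j, ‖w j‖ = r) {h : E → E} (hh : Measurable h) :
    ENNReal.ofReal (Fintype.card J * r ^ 2 / 8) ≤
      Fintype.card J * ∫⁻ z, ENNReal.ofReal (‖h z‖ ^ 2) ∂(stdGaussian E) +
      ∑ j, ∫⁻ z, ENNReal.ofReal (‖h (v j + z) - w j‖ ^ 2) ∂(stdGaussian E) := by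
  -- The estimator induces a test: on `A` it is at least `r / 2` away from `0`, and off `A` at least
  -- `r / 2` away from every `w j`.
  set A : Set E := {z | r / 2 ≤ ‖h z‖}
  have hA : MeasurableSet A := measurableSet_le (by fun_prop) (by fun_prop)
  have key {f : E → ℝ} {B : Set E} (hB : MeasurableSet B) (hf : ∀ z ∈ B, r / 2 ≤ f z) :
      ENNReal.ofReal (r ^ 2 / 4) * stdGaussian E B ≤
        ∫⁻ z, ENNReal.ofReal (f z ^ 2) ∂(stdGaussian E) := by
    rw [← lintegral_indicator_const hB]
    refine lintegral_mono fun z ↦ ?_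
    by_cases hz : z ∈ B
    · rw [Set.indicator_of_mem hz]
      refine ENNReal.ofReal_le_ofReal ?_
      have := hf z hz
      nlinarith
    · simp [Set.indicator_of_notMem hz]
  calc ENNReal.ofReal (Fintype.card J * r ^ 2 / 8)
      = ENNReal.ofReal (r ^ 2 / 4) * ENNReal.ofReal (Fintype.card J / 2) := by
        rw [← ENNReal.ofReal_mul (by positivity)]
        congr 1
        ring
    _ ≤ ENNReal.ofReal (r ^ 2 / 4) * (Fintype.card J * stdGaussian E A +
          ∑ j, stdGaussian E ((v j + ·) ⁻¹' Aᶜ)) := by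
        gcongr
        exact le_add_measure_of_chiSq v hv hA
    _ = Fintype.card J * (ENNReal.ofReal (r ^ 2 / 4) * stdGaussian E A) +
          ∑ j, ENNReal.ofReal (r ^ 2 / 4) * stdGaussian E ((v j + ·) ⁻¹' Aᶜ) := by
        rw [mul_add, Finset.mul_sum, mul_left_comm]
    _ ≤ _ := by
        gcongr with j
        · exact key hA fun z hz ↦ hz
        · refine key (measurable_const_add (v j) hA.compl) fun z hz ↦ ?_
          have hz' : ‖h (v j + z)‖ < r / 2 := not_le.1 hz
          have := norm_sub_norm_le (w j) (h (v j + z))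
          rw [norm_sub_rev, hw] at this
          linarith

end TwoHypotheses

/-! ### Product priors over disjoint blocks. -/

/-- Resampling one coordinate preserves the uniform distribution: exchanging `c b` with the fresh
value is an involution. -/
lemma card_mul_sum_eq_sum_sum_update {α β M : Type*} [Fintype α] [Fintype β] [DecidableEq β]
    [NonAssocSemiring M] (b : β) (F : (β → α) → M) :
    Fintype.card α * ∑ c, F c = ∑ c, ∑ o, F (Function.update c b o) := by
  let e : ((β → α) × α) ≃ ((β → α) × α) :=
    Function.Involutive.toPerm (fun p ↦ (Function.update p.1 b p.2, p.1 b)) fun p ↦ by simp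
  calc (Fintype.card α : M) * ∑ c, F c = ∑ p : (β → α) × α, F p.1 := by
        rw [Fintype.sum_prod_type]
        simp [Finset.mul_sum]
    _ = ∑ p : (β → α) × α, F (e p).1 := (e.sum_comp fun p ↦ F p.1).symm
    _ = _ := by rw [Fintype.sum_prod_type]; rfl

section Blocks

variable {n : ℕ}

/-- Restriction of a vector to the coordinates in `B`. -/
def coordRestrict (B : Finset (Fin n)) (x : EuclideanSpace ℝ (Fin n)) : EuclideanSpace ℝ (Fin n) :=
  WithLp.toLp 2 fun i ↦ if i ∈ B then x i else 0

lemma coordRestrict_apply (B : Finset (Fin n)) (x : EuclideanSpace ℝ (Fin n)) (i : Fin n) :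
    coordRestrict B x i = if i ∈ B then x i else 0 := rfl

lemma measurable_coordRestrict (B : Finset (Fin n)) : Measurable (coordRestrict B) := by
  unfold coordRestrict
  refine (WithLp.measurable_toLp 2 _).comp (measurable_pi_lambda _ fun i ↦ ?_)
  split_ifs <;> fun_prop

lemma sum_norm_sq_coordRestrict_le {β : Type*} [Fintype β] {B : β → Finset (Fin n)}
    (hB : Pairwise (Function.onFun Disjoint B)) (x : EuclideanSpace ℝ (Fin n)) :
    ∑ b, ‖coordRestrict (B b) x‖ ^ 2 ≤ ‖x‖ ^ 2 := by
  simp_rw [EuclideanSpace.real_norm_sq_eq, coordRestrict_apply]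
  rw [Finset.sum_comm]
  refine Finset.sum_le_sum fun i _ ↦ ?_
  by_cases h : ∃ b, i ∈ B b
  · obtain ⟨b, hb⟩ := h
    rw [Finset.sum_eq_single b]
    · simp [hb]
    · intro b' _ hbb
      have : i ∉ B b' := fun h ↦ (Finset.disjoint_left.1 (hB hbb) h) hb
      simp [this]
    · simp
  · push Not at h
    simp [h, sq_nonneg]

lemma coordRestrict_sub (B : Finset (Fin n)) (x y : EuclideanSpace ℝ (Fin n)) :
    coordRestrict B (x - y) = coordRestrict B x - coordRestrict B y := by
  ext i
  simp only [coordRestrict_apply, PiLp.sub_apply]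
  split_ifs <;> simp

lemma coordRestrict_smul_sum {β : Type*} [Fintype β] {B : β → Finset (Fin n)}
    (hB : Pairwise (Function.onFun Disjoint B)) {u : β → EuclideanSpace ℝ (Fin n)}
    (hu : ∀ b, ∀ i ∉ B b, u b i = 0) (σ : ℝ) (b : β) :
    coordRestrict (B b) (σ • ∑ b, u b) = σ • u b := by
  ext i
  rw [coordRestrict_apply]
  split_ifs with hi
  · simp only [PiLp.smul_apply, WithLp.ofLp_sum, Finset.sum_apply, smul_eq_mul]
    rw [Finset.sum_eq_single b]
    · intro b' _ hbb
      exact hu b' i fun h ↦ (Finset.disjoint_left.1 (hB hbb) h) hi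
    · simp
  · simp [hu b i hi]

/-- Minimax lower bound from a product prior over disjoint blocks of coordinates, in each of which
the signal is zero or one of the vectors `σ • v b j`. -/
lemma le_minimaxRisk_of_blocks {σ : ℝ} (hσ : 0 < σ) {T : Set (EuclideanSpace ℝ (Fin n))}
    {β J : Type*} [Fintype β] [Fintype J] [Nonempty J]
    {B : β → Finset (Fin n)} (hB : Pairwise (Function.onFun Disjoint B))
    (v : β → J → EuclideanSpace ℝ (Fin n)) (hvB : ∀ b j, ∀ i ∉ B b, v b j i = 0)
    {a : ℝ} (ha : 0 ≤ a) (hva : ∀ b j, ‖v b j‖ = a)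
    (hv : ∀ b, ∑ j, ∑ l, Real.exp (inner ℝ (v b j) (v b l)) ≤ 2 * (Fintype.card J : ℝ) ^ 2)
    (hT : ∀ c : β → J ⊕ J, σ • ∑ b, Sum.elim (fun _ ↦ 0) (v b) (c b) ∈ T) :
    ENNReal.ofReal (Fintype.card β * (σ * a) ^ 2 / 16) ≤ minimaxRisk n σ T := by
  classical
  refine le_iInf₂ fun est hest ↦ ?_
  set S := ⨆ θ ∈ T, risk n σ est θ
  set γ := stdGaussian (EuclideanSpace ℝ (Fin n))
  set N : ℝ := (Fintype.card J : ℝ) with hN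
  have hN0 : 0 < N := by rw [hN]; exact_mod_cast Fintype.card_pos
  -- All `Sum.inl` labels give the zero signal, so uniform labels in `J ⊕ J` put mass `1/2` on zero
  -- without explicit weights.
  set s : (β → J ⊕ J) → EuclideanSpace ℝ (Fin n) := fun c ↦ σ • ∑ b, Sum.elim (fun _ ↦ 0) (v b) (c b) with hs
  have hs' (c : β → J ⊕ J) (b : β) :
      coordRestrict (B b) (s c) = σ • Sum.elim (fun _ ↦ 0) (v b) (c b) := by
    refine coordRestrict_smul_sum hB (u := fun b ↦ Sum.elim (fun _ ↦ 0) (v b) (c b)) (fun b i hi ↦ ?_) σ b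
    rcases c b with j | j
    · simp
    · exact hvB b j i hi
  let F : β → (β → J ⊕ J) → ℝ≥0∞ := fun b c ↦
    ∫⁻ z, ENNReal.ofReal (‖coordRestrict (B b) (est (s c + σ • z)) -
      σ • Sum.elim (fun _ ↦ 0) (v b) (c b)‖ ^ 2) ∂γ
  have hmQ := fun b ↦ measurable_coordRestrict (B b)
  have hrisk (c : β → J ⊕ J) : ∑ b, F b c ≤ S := by
    refine le_trans ?_ (le_iSup₂_of_le (s c) (hT c) le_rfl)
    rw [risk_eq_lintegral_stdGaussian hσ hest]
    simp only [F]
    rw [← lintegral_finsetSum _ fun b _ ↦ by fun_prop]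
    refine lintegral_mono fun z ↦ ?_
    dsimp only
    rw [← ENNReal.ofReal_sum_of_nonneg (fun _ _ ↦ by positivity)]
    refine ENNReal.ofReal_le_ofReal ?_
    simp_rw [← hs', ← coordRestrict_sub]
    exact sum_norm_sq_coordRestrict_le hB _
  -- With the labels of the other blocks frozen, block `b` is a problem of testing against a
  -- mixture, centred at `τ`.
  have hblock (b : β) (c : β → J ⊕ J) :
      ENNReal.ofReal (N * (σ * a) ^ 2 / 8) ≤ ∑ o, F b (Function.update c b o) := by
    obtain ⟨j₀⟩ := ‹Nonempty J›
    set τ := s (Function.update c b (Sum.inl j₀))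
    have hl (j : J) : s (Function.update c b (Sum.inl j)) = τ := by
      simp only [τ, hs]
      congr 1
      refine Finset.sum_congr rfl fun b' _ ↦ ?_
      by_cases h : b' = b
      · subst h; simp
      · simp [Function.update_of_ne h]
    have hr (j : J) : s (Function.update c b (Sum.inr j)) = τ + σ • v b j := by
      simp only [τ, hs]
      rw [← smul_add, ← Finset.add_sum_erase _ _ (Finset.mem_univ b),
        ← Finset.add_sum_erase _ _ (Finset.mem_univ b)]
      simp only [Function.update_self, Sum.elim_inr, Sum.elim_inl, zero_add]
      rw [add_comm]
      congr 2
      refine Finset.sum_congr rfl fun b' hb' ↦ ?_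
      simp [Function.update_of_ne (Finset.ne_of_mem_erase hb')]
    have key := le_lintegral_norm_sq_add_sum (v b) (fun j ↦ σ • v b j) (hv b) (r := σ * a)
      (by positivity) (fun j ↦ by rw [norm_smul, hva, Real.norm_of_nonneg hσ.le])
      (h := fun z ↦ coordRestrict (B b) (est (τ + σ • z))) (by fun_prop)
    refine key.trans (le_of_eq ?_)
    rw [Fintype.sum_sum_type]
    congr 1
    · simp [F, hl, γ]
    · refine Finset.sum_congr rfl fun j _ ↦ ?_
      simp only [F, hr, Function.update_self, Sum.elim_inr, smul_add, add_assoc]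
      rfl
  have hcard : (Fintype.card (J ⊕ J) : ℝ≥0∞) = ENNReal.ofReal (2 * N) := by
    rw [Fintype.card_sum, ← two_mul, hN]
    simp [ENNReal.ofReal_mul]
  have hsum (b : β) : (Fintype.card (β → J ⊕ J) : ℝ≥0∞) * ENNReal.ofReal ((σ * a) ^ 2 / 16) ≤
      ∑ c, F b c := by
    have h1 : (Fintype.card (β → J ⊕ J) : ℝ≥0∞) * ENNReal.ofReal (N * (σ * a) ^ 2 / 8) ≤
        Fintype.card (J ⊕ J) * ∑ c, F b c := by
      rw [card_mul_sum_eq_sum_sum_update b (F b), ← nsmul_eq_mul]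
      exact Finset.card_nsmul_le_sum _ _ _ fun c _ ↦ hblock b c
    rw [hcard, show N * (σ * a) ^ 2 / 8 = 2 * N * ((σ * a) ^ 2 / 16) by ring,
      ENNReal.ofReal_mul (p := 2 * N) (by positivity), mul_left_comm] at h1
    exact (ENNReal.mul_le_mul_iff_right (by simpa using hN0) ENNReal.ofReal_ne_top).1 h1
  have htot : (Fintype.card (β → J ⊕ J) : ℝ≥0∞) *
      ENNReal.ofReal (Fintype.card β * (σ * a) ^ 2 / 16) ≤ Fintype.card (β → J ⊕ J) * S := by
    calc _ = ∑ _b : β, (Fintype.card (β → J ⊕ J) : ℝ≥0∞) * ENNReal.ofReal ((σ * a) ^ 2 / 16) := by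
          rw [Finset.sum_const, Finset.card_univ, nsmul_eq_mul, mul_left_comm, mul_div_assoc,
            ENNReal.ofReal_mul (by positivity), ENNReal.ofReal_natCast]
      _ ≤ ∑ b, ∑ c, F b c := Finset.sum_le_sum fun b _ ↦ hsum b
      _ = ∑ c, ∑ b, F b c := Finset.sum_comm
      _ ≤ ∑ _c : β → J ⊕ J, S := Finset.sum_le_sum fun c _ ↦ hrisk c
      _ = _ := by rw [Finset.sum_const, Finset.card_univ, nsmul_eq_mul]
  exact (ENNReal.mul_le_mul_iff_right (by simp [Fintype.card_eq_zero_iff])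
    (ENNReal.natCast_ne_top _)).1 htot

end Blocks

/-! ### Lower bounds in the three regimes. -/

/-- The vector whose first `m` coordinates are `t` and whose other coordinates vanish. -/
def prefixVec (n m : ℕ) (t : ℝ) : EuclideanSpace ℝ (Fin n) :=
  WithLp.toLp 2 fun i ↦ if (i : ℕ) < m then t else 0

lemma prefixVec_apply {n m : ℕ} {t : ℝ} (i : Fin n) :
    prefixVec n m t i = if (i : ℕ) < m then t else 0 := rfl

lemma inner_prefixVec {n m l : ℕ} (hm : m ≤ n) (s t : ℝ) :
    inner ℝ (prefixVec n m s) (prefixVec n l t) = s * t * (min m l : ℕ) := by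
  have h : ∀ i : Fin n, inner ℝ (prefixVec n m s i) (prefixVec n l t i) =
      if (i : ℕ) < min m l then s * t else 0 := by
    intro i
    simp only [prefixVec_apply, lt_min_iff]
    by_cases h1 : (i : ℕ) < m <;> by_cases h2 : (i : ℕ) < l <;> simp [h1, h2, mul_comm]
  rw [PiLp.inner_apply, Finset.sum_congr rfl fun i _ ↦ h i,
    Fin.sum_univ_eq_sum_range (fun i ↦ if i < min m l then s * t else 0), ← Finset.sum_filter,
    Finset.sum_const, nsmul_eq_mul, mul_comm]
  congr 2
  have : (Finset.range n).filter (· < min m l) = Finset.range (min m l) := by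
    ext i
    simp only [Finset.mem_filter, Finset.mem_range]
    omega
  rw [this, Finset.card_range]

lemma smul_prefixVec_mem_Theta {n m k : ℕ} (hk : 2 ≤ k) (σ t : ℝ) :
    σ • prefixVec n m t ∈ Theta n k := by
  refine mem_Theta_of_monotone (c := fun i ↦ if i < m then 0 else 1) (fun i j hij ↦ ?_)
    (fun i _ ↦ ?_) (fun l ↦ if l = 0 then σ * t else 0) fun i ↦ ?_
  · dsimp only
    split_ifs <;> omega
  · split_ifs <;> omega
  · by_cases h : (i : ℕ) < m <;> simp [prefixVec_apply, h]

lemma le_minimaxRisk_Theta_one {n : ℕ} (hn : 1 ≤ n) {σ : ℝ} (hσ : 0 < σ) :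
    ENNReal.ofReal (1 / 32 * σ ^ 2) ≤ minimaxRisk n σ (Theta n 1) := by
  have hn0 : (0 : ℝ) < n := by exact_mod_cast hn
  have hl : 0 < Real.log 2 := Real.log_pos one_lt_two
  have hl2 := Real.log_two_gt_d9
  -- Energy `log 2` is the largest that the `χ²` condition `exp ‖v‖² ≤ 2` allows for a single
  -- alternative.
  have hin : inner ℝ (prefixVec n n √(Real.log 2 / n)) (prefixVec n n √(Real.log 2 / n)) =
      Real.log 2 := by
    rw [inner_prefixVec le_rfl, Real.mul_self_sqrt (by positivity), min_self]
    field_simp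
  refine le_trans (ENNReal.ofReal_le_ofReal ?_) (le_minimaxRisk_of_blocks hσ (β := Unit) (J := Unit)
    (B := fun _ ↦ Finset.univ) (fun b b' h ↦ (h (Subsingleton.elim _ _)).elim)
    (fun _ _ ↦ prefixVec n n √(Real.log 2 / n)) (by simp) (a := √(Real.log 2)) (by positivity)
    (fun _ _ ↦ ?_) (fun _ ↦ ?_) fun c ↦ ?_)
  · rw [mul_pow, Real.sq_sqrt hl.le, Fintype.card_unit]
    push_cast
    nlinarith [sq_nonneg σ]
  · rw [← Real.sqrt_sq (norm_nonneg _), ← real_inner_self_eq_norm_sq, hin]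
  · simp only [hin, Finset.sum_const, Real.exp_log (zero_lt_two (α := ℝ))]
    simp
  · refine mem_Theta_of_monotone (c := fun _ ↦ 0) monotone_const (fun _ _ ↦ zero_lt_one)
      (fun _ ↦ σ * Sum.elim (fun _ ↦ 0) (fun _ ↦ √(Real.log 2 / n)) (c ())) fun i ↦ ?_
    rcases h : c () with j | j <;> simp [h, prefixVec_apply]

/-- The fraction is `2^(-|j - l|)`, with row sums at most `4`, and convexity gives `exp (a x) ≤ 1 +
x (exp a - 1)` for `x ∈ [0, 1]`. -/
lemma sum_sum_exp_le_of_geometric {L : ℕ} {a : ℝ} (ha : 0 ≤ a) :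
    ∑ j : Fin L, ∑ l : Fin L,
      Real.exp (a * ((4 : ℝ) ^ min (j : ℕ) l / (2 ^ (j : ℕ) * 2 ^ (l : ℕ)))) ≤
      (L : ℝ) ^ 2 + 4 * L * (Real.exp a - 1) := by
  have he : 0 ≤ Real.exp a - 1 := by linarith [Real.add_one_le_exp a]
  let r : ℕ → ℕ → ℝ := fun j l ↦ if l ≤ j then 2 ^ l / 2 ^ j else 0
  have hr (j l : ℕ) : (4 : ℝ) ^ min j l / (2 ^ j * 2 ^ l) ≤ r j l + r l j := by
    wlog h : l ≤ j generalizing j l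
    · rw [min_comm, mul_comm, add_comm]
      exact this l j (by omega)
    have h1 : (4 : ℝ) ^ min j l / (2 ^ j * 2 ^ l) = 2 ^ l / 2 ^ j := by
      rw [min_eq_right h, show (4 : ℝ) = 2 * 2 by norm_num, mul_pow]
      field_simp
    have h2 : 0 ≤ r l j := by simp only [r]; split_ifs <;> positivity
    rw [h1]
    simp only [r, h, if_true] at h2 ⊢
    linarith
  have hr1 (j l : ℕ) : (4 : ℝ) ^ min j l / (2 ^ j * 2 ^ l) ≤ 1 := by
    rw [div_le_one (by positivity), show (4 : ℝ) = 2 * 2 by norm_num, mul_pow]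
    gcongr <;> first | exact min_le_left _ _ | exact min_le_right _ _ | norm_num
  have hsum (j : Fin L) : ∑ l : Fin L, r j l ≤ 2 := by
    rw [Fin.sum_univ_eq_sum_range (fun l ↦ r j l)]
    simp only [r]
    rw [← Finset.sum_filter]
    have : (Finset.range L).filter (· ≤ (j : ℕ)) ⊆ Finset.range (j + 1) := by
      intro i
      simp only [Finset.mem_filter, Finset.mem_range]
      omega
    refine (Finset.sum_le_sum_of_subset_of_nonneg this fun _ _ _ ↦ by positivity).trans ?_
    rw [← Finset.sum_div, geom_sum_eq (by norm_num), div_le_iff₀ (by positivity), pow_succ]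
    norm_num
    linarith
  have hconv {x : ℝ} (h0 : 0 ≤ x) (h1 : x ≤ 1) : Real.exp (a * x) ≤ 1 + x * (Real.exp a - 1) := by
    have := convexOn_exp.2 (Set.mem_univ 0) (Set.mem_univ a) (sub_nonneg.2 h1) h0 (by ring)
    simp only [smul_eq_mul, mul_zero, zero_add, Real.exp_zero, mul_one] at this
    rw [mul_comm a]
    linarith
  calc _ ≤ ∑ j : Fin L, ∑ l : Fin L, (1 + (r j l + r l j) * (Real.exp a - 1)) := by
        refine Finset.sum_le_sum fun j _ ↦ Finset.sum_le_sum fun l _ ↦ ?_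
        refine (hconv (by positivity) (hr1 j l)).trans ?_
        gcongr
        exact hr j l
    _ = (L : ℝ) ^ 2 + (∑ j : Fin L, ∑ l : Fin L, r j l + ∑ j : Fin L, ∑ l : Fin L, r j l) *
          (Real.exp a - 1) := by
        conv_rhs => enter [2, 1, 2]; rw [Finset.sum_comm]
        rw [← Finset.sum_add_distrib, Finset.sum_mul]
        simp_rw [← Finset.sum_add_distrib, Finset.sum_mul]
        simp [Finset.sum_add_distrib, sq]
    _ ≤ (L : ℝ) ^ 2 + (∑ _j : Fin L, 2 + ∑ _j : Fin L, 2) * (Real.exp a - 1) := by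
        gcongr with j _ j _
        · exact hsum j
        · exact hsum j
    _ = _ := by
        rw [Finset.sum_const, Finset.card_univ, Fintype.card_fin, nsmul_eq_mul]
        ring

lemma log_log_le_mul_log {n : ℕ} (hn : 1 ≤ n) :
    Real.log (Real.log (16 * n)) ≤ 20 * Real.log (1 + (Nat.log 4 n + 1 : ℕ) / 4) := by
  have hn0 : (1 : ℝ) ≤ n := by exact_mod_cast hn
  set L := Nat.log 4 n + 1
  have hL : (1 : ℝ) ≤ L := by exact_mod_cast Nat.succ_pos _
  have h1 : (n : ℝ) ≤ 4 ^ L := by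
    exact_mod_cast (Nat.lt_pow_succ_log_self (b := 4) (by norm_num) n).le
  have h2 : Real.log (16 * n) ≤ 4 + 2 * L := by
    calc Real.log (16 * n) ≤ Real.log (2 ^ (4 + 2 * L)) := by
          refine Real.log_le_log (by positivity) ?_
          rw [pow_add, pow_mul]
          norm_num
          exact h1
      _ = (4 + 2 * L) * Real.log 2 := by rw [Real.log_pow]; push_cast; ring
      _ ≤ (4 + 2 * L) * 1 := by
          gcongr
          linarith [Real.log_two_lt_d9]
      _ = _ := mul_one _
  -- Bernoulli gives `1 + 5L`, which is enough since `L ≥ 1`.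
  have h3 : (4 + 2 * L : ℝ) ≤ (1 + L / 4) ^ 20 := by
    have := one_add_mul_le_pow (a := (L / 4 : ℝ)) (by linarith) 20
    push_cast at this
    linarith
  have h4 : 0 < Real.log (16 * n) := Real.log_pos (by linarith)
  calc _ ≤ Real.log ((1 + L / 4) ^ 20) := Real.log_le_log h4 (h2.trans h3)
    _ = _ := by rw [Real.log_pow]; norm_num

lemma le_minimaxRisk_Theta_two {n : ℕ} (hn : 1 ≤ n) {σ : ℝ} (hσ : 0 < σ) :
    ENNReal.ofReal (1 / 320 * (σ ^ 2 * Real.log (Real.log (16 * n)))) ≤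
      minimaxRisk n σ (Theta n 2) := by
  have hlog := log_log_le_mul_log hn
  set L := Nat.log 4 n + 1 with hLdef
  have hL : (1 : ℝ) ≤ L := by exact_mod_cast Nat.succ_pos _
  -- Chosen so that `L² + 4L (exp A - 1) = 2L²`, the `χ²` budget.
  set A := Real.log (1 + L / 4) with hA
  have hA0 : 0 ≤ A := Real.log_nonneg (by linarith)
  have hexp : Real.exp A = 1 + L / 4 := Real.exp_log (by positivity)
  have hpow (j : Fin L) : 4 ^ (j : ℕ) ≤ n :=
    Nat.pow_le_of_le_log (by omega) (by have := j.2; omega)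
  let v : Fin L → EuclideanSpace ℝ (Fin n) := fun j ↦ prefixVec n (4 ^ (j : ℕ)) (√A / 2 ^ (j : ℕ))
  have hin (j l : Fin L) : inner ℝ (v j) (v l) =
      A * ((4 : ℝ) ^ min (j : ℕ) l / (2 ^ (j : ℕ) * 2 ^ (l : ℕ))) := by
    have h4 : min (4 ^ (j : ℕ)) (4 ^ (l : ℕ)) = 4 ^ min (j : ℕ) l :=
      ((pow_right_mono₀ (by norm_num : 1 ≤ 4)).map_min).symm
    rw [inner_prefixVec (hpow j), div_mul_div_comm, Real.mul_self_sqrt hA0, h4]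
    push_cast
    ring
  have : Nonempty (Fin L) := ⟨⟨0, by omega⟩⟩
  refine le_trans (ENNReal.ofReal_le_ofReal ?_) (le_minimaxRisk_of_blocks hσ (β := Unit)
    (B := fun _ ↦ Finset.univ) (fun b b' h ↦ (h (Subsingleton.elim _ _)).elim)
    (fun _ ↦ v) (by simp) (a := √A) (by positivity)
    (fun _ j ↦ ?_) (fun _ ↦ ?_) fun c ↦ ?_)
  · rw [mul_pow, Real.sq_sqrt hA0, Fintype.card_unit]
    push_cast
    nlinarith [sq_nonneg σ]
  · rw [← Real.sqrt_sq (norm_nonneg _), ← real_inner_self_eq_norm_sq, hin, min_self,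
      show (4 : ℝ) = 2 * 2 by norm_num, mul_pow, div_self (by positivity), mul_one]
  · simp_rw [hin]
    refine (sum_sum_exp_le_of_geometric hA0).trans (le_of_eq ?_)
    rw [hexp, Fintype.card_fin]
    ring
  · rcases h : c () with j | j
    · have h0 : prefixVec n 0 0 = 0 := by ext; simp [prefixVec_apply]
      simpa [h, h0] using smul_prefixVec_mem_Theta (n := n) (m := 0) (k := 2) le_rfl σ 0
    · simpa [h] using smul_prefixVec_mem_Theta le_rfl σ _

/-- Odd labels `2b + 1` mark spikes. The zeros after the spike of block `b` share the label `2(b +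
1)` with those before the next spike, so `2s + 1` labels suffice. -/
lemma mem_Theta_of_spikes {n m s k : ℕ} (hk : 2 * s < k) (q : ℕ → ℕ) (x : ℕ → ℝ)
    {θ : EuclideanSpace ℝ (Fin n)}
    (hθ : ∀ i : Fin n, θ i = if (i : ℕ) / m < s ∧ (i : ℕ) % m = q (i / m) then x (i / m) else 0) :
    θ ∈ Theta n k := by
  refine mem_Theta_of_monotone (c := fun i ↦ if i / m < s then
    2 * (i / m) + (if i % m < q (i / m) then 0 else if i % m = q (i / m) then 1 else 2) else 2 * s)
    (fun i j hij ↦ ?_) (fun i _ ↦ ?_)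
    (fun l ↦ if l % 2 = 1 then x (l / 2) else 0) fun i ↦ ?_
  · dsimp only
    have h1 : i / m ≤ j / m := Nat.div_le_div_right hij
    have h2 := Nat.div_add_mod i m
    have h3 := Nat.div_add_mod j m
    rcases h1.eq_or_lt with h | h
    · rw [h] at h2 ⊢
      have : i % m ≤ j % m := by omega
      split_ifs <;> omega
    · split_ifs <;> omega
  · split_ifs <;> omega
  · rw [hθ]
    generalize (i : ℕ) / m = b
    generalize (i : ℕ) % m = r
    by_cases hb : b < s
    · by_cases h1 : r = q b
      · subst h1
        simp only [hb, lt_irrefl, true_and, if_true, if_false]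
        rw [if_pos (by omega), show (2 * b + 1) / 2 = b by omega]
      · by_cases h2 : r < q b <;> simp [hb, h1, h2]
    · simp [hb]

lemma mul_log_le_of_div {n k : ℕ} (hk : 3 ≤ k) (hkn : k ≤ n) :
    1 / 8 * (k * Real.log (Real.exp 1 * n / k)) ≤
      ((k - 1) / 2 : ℕ) * Real.log (1 + (n / ((k - 1) / 2) : ℕ)) := by
  set s := (k - 1) / 2 with hs
  have hs1 : 1 ≤ s := by omega
  have hs0 : (0 : ℝ) < s := by exact_mod_cast hs1
  have hsk : (k : ℝ) ≤ 4 * s := by exact_mod_cast (by omega : k ≤ 4 * s)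
  have hsk2 : 2 * (s : ℝ) ≤ k := by exact_mod_cast (by omega : 2 * s ≤ k)
  have hk0 : (0 : ℝ) < k := by exact_mod_cast (by omega : 0 < k)
  have hkn' : (k : ℝ) ≤ n := by exact_mod_cast hkn
  have hx : 1 ≤ (n : ℝ) / k := by rwa [one_le_div hk0]
  -- From `2s ≤ k`. The extra `log 2 ≥ 1/2` absorbs the `1` in `log (e n / k)`.
  have h1 : 2 * ((n : ℝ) / k) ≤ 1 + (n / s : ℕ) := by
    have h : (n : ℝ) / s ≤ 1 + (n / s : ℕ) := by
      rw [div_le_iff₀ hs0]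
      have : n < (1 + n / s) * s := by
        rw [add_comm, mul_comm]
        exact Nat.lt_mul_div_succ n hs1
      exact_mod_cast this.le
    refine le_trans ?_ h
    rw [← mul_div_assoc, div_le_div_iff₀ hk0 hs0]
    nlinarith
  have h2 : Real.log (Real.exp 1 * n / k) = 1 + Real.log (n / k) := by
    rw [mul_div_assoc, Real.log_mul (by positivity) (by positivity), Real.log_exp]
  have h3 : Real.log 2 + Real.log (n / k) ≤ Real.log (1 + (n / s : ℕ)) := by
    rw [← Real.log_mul (by positivity) (by positivity)]
    exact Real.log_le_log (by positivity) h1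
  have h4 := Real.log_nonneg hx
  have h5 := Real.log_two_gt_d9
  calc 1 / 8 * (k * Real.log (Real.exp 1 * n / k)) = k / 4 * ((1 + Real.log (n / k)) / 2) := by
        rw [h2]; ring
    _ ≤ s * Real.log (1 + (n / s : ℕ)) := by
        gcongr
        · linarith
        · linarith

lemma le_minimaxRisk_Theta {n k : ℕ} (hk : 3 ≤ k) (hkn : k ≤ n) {σ : ℝ} (hσ : 0 < σ) :
    ENNReal.ofReal (1 / 128 * (σ ^ 2 * k * Real.log (Real.exp 1 * n / k))) ≤
      minimaxRisk n σ (Theta n k) := by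
  have hlog := mul_log_le_of_div hk hkn
  set s := (k - 1) / 2 with hs
  have hs1 : 1 ≤ s := by omega
  set m := n / s with hm
  have hm1 : 1 ≤ m := (Nat.one_le_div_iff hs1).2 (by omega)
  have hsm : s * m ≤ n := Nat.mul_div_le n s
  have hm0 : (1 : ℝ) ≤ m := by exact_mod_cast hm1
  -- With orthogonal spikes each row of the `χ²` sum is `(m - 1) + exp A = 2m`, exactly the budget.
  set A := Real.log (1 + m) with hA
  have hA0 : 0 ≤ A := Real.log_nonneg (by linarith)
  have hexp : Real.exp A = 1 + m := Real.exp_log (by positivity)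
  have hlt (b : Fin s) (q : Fin m) : (b : ℕ) * m + q < n := by
    have h1 : ((b : ℕ) + 1) * m ≤ s * m := Nat.mul_le_mul_right _ b.2
    rw [Nat.add_mul, one_mul] at h1
    have := q.2
    omega
  have hdiv (b : Fin s) (q : Fin m) : ((b : ℕ) * m + q) / m = b := by
    rw [mul_comm, Nat.mul_add_div hm1, Nat.div_eq_of_lt q.2, add_zero]
  have hmod (b : Fin s) (q : Fin m) : ((b : ℕ) * m + q) % m = q := by
    rw [mul_comm, Nat.mul_add_mod, Nat.mod_eq_of_lt q.2]
  let v : Fin s → Fin m → EuclideanSpace ℝ (Fin n) :=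
    fun b q ↦ EuclideanSpace.single ⟨b * m + q, hlt b q⟩ √A
  have : Nonempty (Fin m) := ⟨⟨0, hm1⟩⟩
  refine le_trans (ENNReal.ofReal_le_ofReal ?_) (le_minimaxRisk_of_blocks hσ
    (B := fun b : Fin s ↦ Finset.univ.filter fun i : Fin n ↦ (i : ℕ) / m = b) (fun b b' h ↦ ?_)
    v (fun b q i hi ↦ ?_) (a := √A) (by positivity) (fun b q ↦ ?_) (fun b ↦ ?_) fun c ↦ ?_)
  · rw [mul_pow, Real.sq_sqrt hA0, Fintype.card_fin]
    nlinarith [sq_nonneg σ]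
  · refine Finset.disjoint_left.2 fun i hi hi' ↦ h (Fin.ext ?_)
    rw [← (Finset.mem_filter.1 hi).2, ← (Finset.mem_filter.1 hi').2]
  · simp only [v, PiLp.single_apply]
    rw [if_neg]
    rintro rfl
    exact hi (by simp [hdiv])
  · simp [v]
  · have hin (q q' : Fin m) : inner ℝ (v b q) (v b q') = if q = q' then A else 0 := by
      by_cases h : q = q'
      · simp [v, h, Real.sq_sqrt hA0]
      · have : (q : ℕ) ≠ q' := fun h' ↦ h (Fin.ext h')
        simp only [v]
        rw [EuclideanSpace.inner_single_left, PiLp.single_apply, if_neg, if_neg h, mul_zero]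
        simpa using this
    have hsum (q : Fin m) : ∑ q', Real.exp (inner ℝ (v b q) (v b q')) = 2 * m := by
      have : ∀ q', Real.exp (inner ℝ (v b q) (v b q')) = 1 + if q = q' then (m : ℝ) else 0 := by
        intro q'
        rw [hin]
        split_ifs <;> simp [hexp]
      simp_rw [this, Finset.sum_add_distrib]
      simp
      ring
    simp_rw [hsum]
    simp
    exact le_of_eq (by ring)
  -- A block with zero signal is treated as a spike of height `0` at the position given by its
  -- label.
  · refine mem_Theta_of_spikes (m := m) (s := s) (by omega)
      (fun b ↦ if h : b < s then Sum.elim Fin.val Fin.val (c ⟨b, h⟩) else 0)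
      (fun b ↦ if h : b < s then Sum.elim (fun _ ↦ 0) (fun _ ↦ σ * √A) (c ⟨b, h⟩) else 0) fun i ↦ ?_
    have hterm (b : Fin s) : (Sum.elim (fun _ ↦ 0) (v b) (c b) : EuclideanSpace ℝ (Fin n)) i =
        if (i : ℕ) / m = b ∧ (i : ℕ) % m = Sum.elim Fin.val Fin.val (c b)
          then Sum.elim (fun _ ↦ 0) (fun _ ↦ √A) (c b) else 0 := by
      rcases c b with q | q
      · exact (ite_self (0 : ℝ)).symm
      · simp only [Sum.elim_inr, v, PiLp.single_apply]
        congr 1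
        rw [eq_iff_iff]
        constructor
        · rintro rfl
          exact ⟨hdiv b q, hmod b q⟩
        · rintro ⟨h1, h2⟩
          refine Fin.ext ?_
          rw [← Nat.div_add_mod' i m, h1, h2]
    simp only [PiLp.smul_apply, WithLp.ofLp_sum, Finset.sum_apply, smul_eq_mul, hterm]
    by_cases h : (i : ℕ) / m < s
    · rw [Finset.sum_eq_single ⟨(i : ℕ) / m, h⟩]
      · simp only [h, true_and, dif_pos]
        split_ifs
        · rcases c ⟨(i : ℕ) / m, h⟩ <;> simp
        · simp
      · intro b _ hb
        rw [if_neg]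
        rintro ⟨h1, -⟩
        exact hb (Fin.ext h1.symm)
      · simp
    · rw [if_neg (by tauto), Finset.sum_eq_zero, mul_zero]
      intro b _
      rw [if_neg]
      rintro ⟨h1, -⟩
      exact h (h1 ▸ b.2)

/-! ### Maximal inequalities for Gaussian sums along chains. -/

section Chains

variable {n : ℕ}

/-- The sum of the coordinates in `B`. -/
def coordSum (B : Finset (Fin n)) (z : EuclideanSpace ℝ (Fin n)) : ℝ := ∑ i ∈ B, z i

@[fun_prop]
lemma measurable_coordSum (B : Finset (Fin n)) : Measurable (coordSum B) := by
  unfold coordSum; fun_prop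

/-- The isometry that changes the signs of all coordinates outside `B`. -/
noncomputable def signFlip (B : Finset (Fin n)) : EuclideanSpace ℝ (Fin n) ≃ₗᵢ[ℝ] EuclideanSpace ℝ (Fin n) :=
  LinearIsometryEquiv.piLpCongrRight 2 fun i ↦
    if i ∈ B then LinearIsometryEquiv.refl ℝ ℝ else LinearIsometryEquiv.neg ℝ

lemma signFlip_apply (B : Finset (Fin n)) (z : EuclideanSpace ℝ (Fin n)) (i : Fin n) :
    signFlip B z i = if i ∈ B then z i else -z i := by
  simp only [signFlip, LinearIsometryEquiv.piLpCongrRight_apply]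
  split_ifs <;> simp

lemma coordSum_signFlip_of_subset {A B : Finset (Fin n)} (h : A ⊆ B)
    (z : EuclideanSpace ℝ (Fin n)) : coordSum A (signFlip B z) = coordSum A z :=
  Finset.sum_congr rfl fun i hi ↦ by rw [signFlip_apply, if_pos (h hi)]

lemma coordSum_signFlip_of_superset {A B : Finset (Fin n)} (h : A ⊆ B)
    (z : EuclideanSpace ℝ (Fin n)) :
    coordSum B (signFlip A z) = 2 * coordSum A z - coordSum B z := by
  simp only [coordSum]
  have h1 (z : EuclideanSpace ℝ (Fin n)) := Finset.sum_sdiff (f := fun i ↦ z i) h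
  rw [← h1, ← h1 z, Finset.sum_congr rfl fun i hi ↦ by
      rw [signFlip_apply, if_neg (Finset.mem_sdiff.1 hi).2],
    Finset.sum_congr (s₁ := A) rfl fun i hi ↦ by rw [signFlip_apply, if_pos hi],
    Finset.sum_neg_distrib]
  ring

lemma stdGaussian_preimage_signFlip (B : Finset (Fin n)) {s : Set (EuclideanSpace ℝ (Fin n))}
    (hs : MeasurableSet s) :
    stdGaussian (EuclideanSpace ℝ (Fin n)) (signFlip B ⁻¹' s) =
      stdGaussian (EuclideanSpace ℝ (Fin n)) s := by
  conv_rhs => rw [← stdGaussian_map (signFlip B)]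
  rw [Measure.map_apply (signFlip B).continuous.measurable hs]

/-- Lévy's maximal inequality for the coordinate sums over an increasing chain of sets. -/
lemma measure_exists_le_coordSum_sq_le {A : ℕ → Finset (Fin n)} (hA : Monotone A) (F : Finset ℕ)
    {B : Finset (Fin n)} (hB : ∀ m ∈ F, A m ⊆ B) (t : ℝ) :
    stdGaussian (EuclideanSpace ℝ (Fin n)) {z | ∃ m ∈ F, t ≤ coordSum (A m) z ^ 2} ≤
      2 * stdGaussian (EuclideanSpace ℝ (Fin n)) {z | t ≤ coordSum B z ^ 2} := by
  set γ := stdGaussian (EuclideanSpace ℝ (Fin n))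
  set C := {z : EuclideanSpace ℝ (Fin n) | t ≤ coordSum B z ^ 2}
  have hC : MeasurableSet C := measurableSet_le (by fun_prop) (by fun_prop)
  -- `m` is the first index reaching the level. The event depends only on coordinates in `A m`, so
  -- `signFlip (A m)` preserves it.
  let D : ℕ → Set (EuclideanSpace ℝ (Fin n)) := fun m ↦
    {z | t ≤ coordSum (A m) z ^ 2} ∩ ⋂ l ∈ F.filter (· < m), {z | coordSum (A l) z ^ 2 < t}
  have hD (m : ℕ) : MeasurableSet (D m) :=
    (measurableSet_le (by fun_prop) (by fun_prop)).inter
      (Finset.measurableSet_biInter _ fun l _ ↦ measurableSet_lt (by fun_prop) (by fun_prop))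
  have hDmem (m : ℕ) (z) : z ∈ D m ↔
      t ≤ coordSum (A m) z ^ 2 ∧ ∀ l ∈ F, l < m → coordSum (A l) z ^ 2 < t := by
    simp [D]
  have hdisj : (F : Set ℕ).PairwiseDisjoint fun m ↦ D m ∩ C := by
    intro m hm l hl hml
    refine Set.disjoint_left.2 fun z hz hz' ↦ ?_
    have h1 := (hDmem m z).1 hz.1
    have h2 := (hDmem l z).1 hz'.1
    rcases lt_or_gt_of_ne hml with h | h
    · exact absurd h1.1 (not_le.2 (h2.2 m hm h))
    · exact absurd h2.1 (not_le.2 (h1.2 l hl h))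
  have hstep (m : ℕ) (hm : m ∈ F) : γ (D m) ≤ 2 * γ (D m ∩ C) := by
    have hflip : signFlip (A m) ⁻¹' (D m) = D m := by
      ext z
      rw [Set.mem_preimage, hDmem, hDmem, coordSum_signFlip_of_subset subset_rfl]
      refine and_congr_right fun _ ↦ forall₃_congr fun l _ hl ↦ ?_
      rw [coordSum_signFlip_of_subset (hA hl.le)]
    -- The sum over `A m` is the average of the sum over `B` and its reflection, so one of these has
    -- square at least `t`.
    have hcover : D m ⊆ (D m ∩ C) ∪ (D m ∩ signFlip (A m) ⁻¹' C) := by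
      intro z hz
      rw [← Set.inter_union_distrib_left]
      refine ⟨hz, ?_⟩
      by_contra h
      simp only [C, Set.mem_union, Set.mem_preimage, Set.mem_ofPred_eq, not_or, not_le,
        coordSum_signFlip_of_superset (hB m hm)] at h
      nlinarith [((hDmem m z).1 hz).1, sq_nonneg (coordSum (A m) z - coordSum B z)]
    calc γ (D m) ≤ γ (D m ∩ C) + γ (D m ∩ signFlip (A m) ⁻¹' C) :=
          (measure_mono hcover).trans (measure_union_le _ _)
      _ = γ (D m ∩ C) + γ (signFlip (A m) ⁻¹' (D m ∩ C)) := by rw [Set.preimage_inter, hflip]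
      _ = 2 * γ (D m ∩ C) := by
          rw [stdGaussian_preimage_signFlip _ ((hD m).inter hC), two_mul]
  have hunion : {z | ∃ m ∈ F, t ≤ coordSum (A m) z ^ 2} ⊆ ⋃ m ∈ F, D m := by
    rintro z ⟨m, hm, hz⟩
    classical
    have hne : (F.filter fun m ↦ t ≤ coordSum (A m) z ^ 2).Nonempty :=
      ⟨m, Finset.mem_filter.2 ⟨hm, hz⟩⟩
    obtain ⟨p, hp, hmin⟩ := Finset.exists_min_image _ id hne
    rw [Finset.mem_filter] at hp
    refine Set.mem_iUnion₂.2 ⟨p, hp.1, (hDmem p z).2 ⟨hp.2, fun l hl hlt ↦ ?_⟩⟩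
    by_contra h
    exact absurd hlt (not_lt.2 (hmin l (Finset.mem_filter.2 ⟨hl, not_lt.1 h⟩)))
  calc γ {z | ∃ m ∈ F, t ≤ coordSum (A m) z ^ 2} ≤ ∑ m ∈ F, γ (D m) :=
        (measure_mono hunion).trans (measure_biUnion_finset_le _ _)
    _ ≤ ∑ m ∈ F, 2 * γ (D m ∩ C) := Finset.sum_le_sum hstep
    _ = 2 * γ (⋃ m ∈ F, D m ∩ C) := by
        rw [← Finset.mul_sum, measure_biUnion_finset hdisj fun m _ ↦ (hD m).inter hC]
    _ ≤ 2 * γ C := by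
        gcongr
        exact Set.iUnion₂_subset fun m _ ↦ Set.inter_subset_right

lemma lintegral_exp_coordSum_sq_le {B : Finset (Fin n)} {b : ℝ} (hb : 0 ≤ b)
    (hbB : b * B.card ≤ 1 / 4) :
    ∫⁻ z, ENNReal.ofReal (Real.exp (b * coordSum B z ^ 2))
      ∂(stdGaussian (EuclideanSpace ℝ (Fin n))) ≤ 2 := by
  let u : EuclideanSpace ℝ (Fin n) := WithLp.toLp 2 fun i ↦ if i ∈ B then 1 else 0
  let W := Submodule.span ℝ {u}
  have hu : ‖u‖ ^ 2 = B.card := by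
    rw [EuclideanSpace.real_norm_sq_eq]
    simp [u]
  have hin (z : EuclideanSpace ℝ (Fin n)) : coordSum B z = inner ℝ z u := by
    rw [PiLp.inner_apply]
    simp [u, coordSum]
  have hsq (z : EuclideanSpace ℝ (Fin n)) :
      coordSum B z ^ 2 ≤ ‖W.orthogonalProjectionOnto z‖ ^ 2 * B.card := by
    have h : coordSum B z = inner ℝ (W.orthogonalProjectionOnto z)
        ⟨u, Submodule.mem_span_singleton_self u⟩ := by
      simp [hin]
    rw [h, ← hu, ← mul_pow, ← sq_abs]
    gcongr
    exact abs_real_inner_le_norm _ _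
  have hdim : Module.finrank ℝ W ≤ 1 := by
    simpa using finrank_span_le_card (R := ℝ) ({u} : Set (EuclideanSpace ℝ (Fin n)))
  calc _ ≤ ∫⁻ z, ENNReal.ofReal (Real.exp (‖W.orthogonalProjectionOnto z‖ ^ 2 / 4))
        ∂(stdGaussian (EuclideanSpace ℝ (Fin n))) := by
        refine lintegral_mono fun z ↦ ENNReal.ofReal_le_ofReal (Real.exp_le_exp.2 ?_)
        have h1 := mul_le_mul_of_nonneg_left (hsq z) hb
        have h2 := mul_le_mul_of_nonneg_left hbB (sq_nonneg ‖W.orthogonalProjectionOnto z‖)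
        linarith
    _ = ENNReal.ofReal (2 ^ (Module.finrank ℝ W / 2 : ℝ)) :=
        lintegral_exp_norm_sq_orthogonalProjectionOnto W
    _ ≤ ENNReal.ofReal 2 := by
        refine ENNReal.ofReal_le_ofReal ?_
        have h : (Module.finrank ℝ W / 2 : ℝ) ≤ 1 := by
          have : (Module.finrank ℝ W : ℝ) ≤ 1 := by exact_mod_cast hdim
          linarith
        simpa using Real.rpow_le_rpow_of_exponent_le (by norm_num : (1 : ℝ) ≤ 2) h
    _ = 2 := by simp

lemma measurable_sup'_coordSum_sq (A : ℕ → Finset (Fin n)) {F : Finset ℕ} (hF : F.Nonempty) :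
    Measurable fun z ↦ F.sup' hF fun m ↦ coordSum (A m) z ^ 2 := by
  have h : (fun z ↦ F.sup' hF fun m ↦ coordSum (A m) z ^ 2) =
      F.sup' hF fun m z ↦ coordSum (A m) z ^ 2 := by
    ext z
    rw [Finset.sup'_apply]
  rw [h]
  exact Finset.measurable_sup' hF fun m _ ↦ by fun_prop

/-- Lévy's inequality bounds every tail of the supremum by twice that of the largest set, and the
layer-cake formula carries the factor `2` over to exponential moments. -/
lemma lintegral_exp_sup_coordSum_sq_le {A : ℕ → Finset (Fin n)} (hA : Monotone A) {F : Finset ℕ}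
    (hF : F.Nonempty) {b : ℝ} (hb : 0 < b) (hbA : ∀ m ∈ F, b * (A m).card ≤ 1 / 4) :
    ∫⁻ z, ENNReal.ofReal (Real.exp (b * F.sup' hF fun m ↦ coordSum (A m) z ^ 2))
      ∂(stdGaussian (EuclideanSpace ℝ (Fin n))) ≤ 4 := by
  have hB : ∀ m ∈ F, A m ⊆ A (F.max' hF) := fun m hm ↦ hA (F.le_max' m hm)
  have hmeas := measurable_sup'_coordSum_sq A hF
  rw [lintegral_eq_lintegral_meas_le _ (Filter.Eventually.of_forall fun _ ↦ (Real.exp_pos _).le)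
    (by fun_prop)]
  calc _ ≤ ∫⁻ t in Set.Ioi (0 : ℝ), 2 * stdGaussian (EuclideanSpace ℝ (Fin n))
        {z | t ≤ Real.exp (b * coordSum (A (F.max' hF)) z ^ 2)} := by
        refine setLIntegral_mono' measurableSet_Ioi fun t ht ↦ ?_
        have h (x : ℝ) : t ≤ Real.exp (b * x) ↔ Real.log t / b ≤ x := by
          rw [← Real.log_le_iff_le_exp ht, div_le_iff₀' hb]
        simp_rw [h, Finset.le_sup'_iff]
        exact measure_exists_le_coordSum_sq_le hA F hB _
    _ = 2 * ∫⁻ z, ENNReal.ofReal (Real.exp (b * coordSum (A (F.max' hF)) z ^ 2))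
        ∂(stdGaussian (EuclideanSpace ℝ (Fin n))) := by
        rw [lintegral_const_mul' _ _ (by simp), lintegral_eq_lintegral_meas_le _
          (Filter.Eventually.of_forall fun _ ↦ (Real.exp_pos _).le) (by fun_prop)]
    _ ≤ 2 * 2 := by
        gcongr
        exact lintegral_exp_coordSum_sq_le hb.le (hbA _ (F.max'_mem hF))
    _ = 4 := by norm_num

/-- An iterated-logarithm bound for the normalized sums along a chain: the sets are grouped by the
dyadic size of their cardinality. -/
lemma exists_exp_chain_le {A : ℕ → Finset (Fin n)} (hA : Monotone A) (N : ℕ) :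
    ∃ H : EuclideanSpace ℝ (Fin n) → ℝ, Measurable H ∧ (∀ z, 0 ≤ H z) ∧
      (∀ z, ∀ m < N, (A m).Nonempty →
        Real.exp (coordSum (A m) z ^ 2 / (8 * (A m).card)) ≤ H z) ∧
      ∫⁻ z, ENNReal.ofReal (H z) ∂(stdGaussian (EuclideanSpace ℝ (Fin n))) ≤
        ENNReal.ofReal (4 * (Nat.log 2 n + 1 : ℕ)) := by
  have hblock (j : ℕ) : ∃ H : EuclideanSpace ℝ (Fin n) → ℝ, Measurable H ∧ (∀ z, 0 ≤ H z) ∧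
      (∀ z, ∀ m < N, (A m).Nonempty → Nat.log 2 (A m).card = j →
        Real.exp (coordSum (A m) z ^ 2 / (8 * (A m).card)) ≤ H z) ∧
      ∫⁻ z, ENNReal.ofReal (H z) ∂(stdGaussian (EuclideanSpace ℝ (Fin n))) ≤ 4 := by
    set F := (Finset.range N).filter fun m ↦ (A m).Nonempty ∧ Nat.log 2 (A m).card = j with hFdef
    rcases F.eq_empty_or_nonempty with hF | hF
    · refine ⟨0, measurable_zero, fun _ ↦ le_rfl, fun z m hm hne hj ↦ ?_, by simp⟩
      exact absurd (Finset.mem_filter.2 ⟨Finset.mem_range.2 hm, hne, hj⟩)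
        (hFdef ▸ hF ▸ Finset.notMem_empty m)
    -- As `2^j ≤ |A m| < 2^(j+1)`, the factor is at least `1 / (8 |A m|)` and at most `1 / (4 |A
    -- m|)`.
    · refine ⟨fun z ↦ Real.exp (1 / (8 * 2 ^ j) * F.sup' hF fun m ↦ coordSum (A m) z ^ 2), ?_,
        fun _ ↦ (Real.exp_pos _).le, fun z m hm hne hj ↦ Real.exp_le_exp.2 ?_,
        lintegral_exp_sup_coordSum_sq_le hA hF (by positivity) fun m hm ↦ ?_⟩
      · have hmeas := measurable_sup'_coordSum_sq A hF
        fun_prop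
      · have hmF : m ∈ F := Finset.mem_filter.2 ⟨Finset.mem_range.2 hm, hne, hj⟩
        have h1 := Finset.le_sup' (fun m ↦ coordSum (A m) z ^ 2) hmF
        have h2 : (2 : ℝ) ^ j ≤ (A m).card := by
          rw [← hj]
          exact_mod_cast Nat.pow_log_le_self 2 hne.card_pos.ne'
        calc coordSum (A m) z ^ 2 / (8 * (A m).card) ≤ coordSum (A m) z ^ 2 / (8 * 2 ^ j) := by
              gcongr
          _ = 1 / (8 * 2 ^ j) * coordSum (A m) z ^ 2 := by ring
          _ ≤ _ := by gcongr
      · have h2 : ((A m).card : ℝ) ≤ 2 ^ (j + 1) := by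
          rw [← (Finset.mem_filter.1 hm).2.2]
          exact_mod_cast (Nat.lt_pow_succ_log_self (by norm_num) _).le
        rw [pow_succ] at h2
        rw [one_div, inv_mul_le_iff₀ (by positivity)]
        linarith
  choose H hm h0 hle hint using hblock
  refine ⟨fun z ↦ ∑ j ∈ Finset.range (Nat.log 2 n + 1), H j z, by fun_prop,
    fun z ↦ Finset.sum_nonneg fun j _ ↦ h0 j z, fun z m hmN hne ↦ ?_, ?_⟩
  · have hcard : (A m).card ≤ n := by simpa using Finset.card_le_univ (A m)
    refine (hle _ z m hmN hne rfl).trans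
      (Finset.single_le_sum (f := fun j ↦ H j z) (fun j _ ↦ h0 j z) ?_)
    exact Finset.mem_range.2 (Nat.lt_succ_of_le (Nat.log_mono_right hcard))
  · simp_rw [ENNReal.ofReal_sum_of_nonneg (fun j _ ↦ h0 j _)]
    rw [lintegral_finsetSum _ (by fun_prop)]
    refine (Finset.sum_le_sum fun j _ ↦ hint j).trans (le_of_eq ?_)
    rw [Finset.sum_const, Finset.card_range, nsmul_eq_mul, ENNReal.ofReal_mul (by norm_num),
      ENNReal.ofReal_natCast, mul_comm]
    simp

lemma exists_coordSum_sq_le {A : ℕ → Finset (Fin n)} (hA : Monotone A) (N : ℕ) :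
    ∃ G : EuclideanSpace ℝ (Fin n) → ℝ, Measurable G ∧ (∀ z, 0 ≤ G z) ∧
      (∀ z, ∀ m < N, coordSum (A m) z ^ 2 ≤ (A m).card * G z) ∧
      ∫⁻ z, ENNReal.ofReal (G z) ∂(stdGaussian (EuclideanSpace ℝ (Fin n))) ≤
        ENNReal.ofReal (8 * (Real.log (4 * (Nat.log 2 n + 1 : ℕ)) + 1)) := by
  obtain ⟨H, hm, h0, hle, hint⟩ := exists_exp_chain_le hA N
  set K : ℝ := 4 * (Nat.log 2 n + 1 : ℕ) with hK
  have hK1 : 1 ≤ K := by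
    have : (1 : ℝ) ≤ (Nat.log 2 n + 1 : ℕ) := by exact_mod_cast Nat.succ_pos _
    linarith
  have hl := Real.log_nonneg hK1
  refine ⟨fun z ↦ 8 * (Real.log K + H z / K), by fun_prop, fun z ↦ ?_, fun z m hmN ↦ ?_,
    lintegral_log_add_div_le hK1 hint (by norm_num)⟩
  · have := h0 z
    positivity
  · rcases (A m).eq_empty_or_nonempty with he | hne
    · simp [he, coordSum]
    · have hc : (0 : ℝ) < (A m).card := by exact_mod_cast hne.card_pos
      have h1 := le_log_add_exp_div (coordSum (A m) z ^ 2 / (8 * (A m).card))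
        (show 0 < K by linarith)
      have h2 := div_le_div_of_nonneg_right (hle z m hmN hne) (show 0 ≤ K by linarith)
      have h3 : coordSum (A m) z ^ 2 / (8 * (A m).card) ≤ Real.log K + H z / K := by linarith
      rw [div_le_iff₀ (by positivity)] at h3
      linarith

end Chains

/-- Cauchy–Schwarz without square roots; AM–GM handles the cross term. -/
lemma add_sq_le_of_sq_le_mul {x y f₁ f₂ g₁ g₂ : ℝ} (hf₁ : 0 ≤ f₁) (hf₂ : 0 ≤ f₂) (hg₁ : 0 ≤ g₁)
    (hg₂ : 0 ≤ g₂) (hx : x ^ 2 ≤ f₁ * g₁) (hy : y ^ 2 ≤ f₂ * g₂) :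
    (x + y) ^ 2 ≤ (f₁ + f₂) * (g₁ + g₂) := by
  have h : 2 * x * y ≤ f₁ * g₂ + f₂ * g₁ := by
    refine le_of_sq_le_sq ?_ (by positivity)
    have h1 : x ^ 2 * y ^ 2 ≤ (f₁ * g₁) * (f₂ * g₂) :=
      mul_le_mul hx hy (sq_nonneg _) (by positivity)
    nlinarith [sq_nonneg (f₁ * g₂ - f₂ * g₁)]
  nlinarith

/-! ### The iterated-logarithm upper bound for two pieces. -/

section TwoPieces

variable {n : ℕ}

/-- Vectors with a constant value before position `m` and a constant value from `m` on. -/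
def twoPieceSpace (n m : ℕ) : Submodule ℝ (EuclideanSpace ℝ (Fin n)) where
  carrier := {v | ∃ s t : ℝ, ∀ i : Fin n, v i = if (i : ℕ) < m then s else t}
  add_mem' := by
    rintro v w ⟨s, t, hv⟩ ⟨s', t', hw⟩
    refine ⟨s + s', t + t', fun i ↦ ?_⟩
    rw [PiLp.add_apply, hv, hw]
    split_ifs <;> rfl
  zero_mem' := ⟨0, 0, by simp⟩
  smul_mem' := by
    rintro c v ⟨s, t, hv⟩
    refine ⟨c * s, c * t, fun i ↦ ?_⟩
    rw [PiLp.smul_apply, hv]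
    split_ifs <;> rfl

/-- Cauchy–Schwarz for a vector that is constant on each of three sets covering the indices. -/
lemma inner_sq_le_of_three_pieces {I₁ I₂ I₃ : Finset (Fin n)} {w z : EuclideanSpace ℝ (Fin n)}
    {a b c g₁ g₂ g₃ : ℝ}
    (hw : ∀ i, (i ∈ I₁ ∧ i ∉ I₂ ∧ i ∉ I₃ ∧ w i = a) ∨ (i ∉ I₁ ∧ i ∈ I₂ ∧ i ∉ I₃ ∧ w i = b) ∨
      (i ∉ I₁ ∧ i ∉ I₂ ∧ i ∈ I₃ ∧ w i = c))
    (hg₁ : 0 ≤ g₁) (hg₂ : 0 ≤ g₂) (hg₃ : 0 ≤ g₃) (h₁ : coordSum I₁ z ^ 2 ≤ I₁.card * g₁)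
    (h₂ : coordSum I₂ z ^ 2 ≤ I₂.card * g₂) (h₃ : coordSum I₃ z ^ 2 ≤ I₃.card * g₃) :
    inner ℝ z w ^ 2 ≤ (g₁ + g₂ + g₃) * ‖w‖ ^ 2 := by
  have hin : inner ℝ z w = a * coordSum I₁ z + b * coordSum I₂ z + c * coordSum I₃ z := by
    have h (i : Fin n) : inner ℝ (z i) (w i) = (if i ∈ I₁ then a * z i else 0) +
        (if i ∈ I₂ then b * z i else 0) + (if i ∈ I₃ then c * z i else 0) := by
      rcases hw i with ⟨h1, h2, h3, h⟩ | ⟨h1, h2, h3, h⟩ | ⟨h1, h2, h3, h⟩ <;> simp [h1, h2, h3, h]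
    rw [PiLp.inner_apply, Finset.sum_congr rfl fun i _ ↦ h i]
    simp [Finset.sum_add_distrib, coordSum, Finset.mul_sum]
  have hnorm : ‖w‖ ^ 2 = a ^ 2 * I₁.card + b ^ 2 * I₂.card + c ^ 2 * I₃.card := by
    have h (i : Fin n) : w i ^ 2 = (if i ∈ I₁ then a ^ 2 else 0) +
        (if i ∈ I₂ then b ^ 2 else 0) + (if i ∈ I₃ then c ^ 2 else 0) := by
      rcases hw i with ⟨h1, h2, h3, h⟩ | ⟨h1, h2, h3, h⟩ | ⟨h1, h2, h3, h⟩ <;> simp [h1, h2, h3, h]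
    rw [EuclideanSpace.real_norm_sq_eq, Finset.sum_congr rfl fun i _ ↦ h i]
    simp [Finset.sum_add_distrib, mul_comm]
  have key {x S m g : ℝ} (h : S ^ 2 ≤ m * g) : (x * S) ^ 2 ≤ x ^ 2 * m * g := by
    rw [mul_pow, mul_assoc]
    gcongr
  rw [hin, hnorm]
  have h12 := add_sq_le_of_sq_le_mul (by positivity) (by positivity) hg₁ hg₂
    (key (x := a) h₁) (key (x := b) h₂)
  exact (add_sq_le_of_sq_le_mul (by positivity) (by positivity) (add_nonneg hg₁ hg₂) hg₃ h12
    (key h₃)).trans_eq (mul_comm _ _)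

/-- The indices in `[p, p + m)`. -/
def rightChain (n p m : ℕ) : Finset (Fin n) :=
  Finset.univ.filter fun i ↦ p ≤ (i : ℕ) ∧ (i : ℕ) < p + m

/-- The indices in `[p - m, p)`. -/
def leftChain (n p m : ℕ) : Finset (Fin n) :=
  Finset.univ.filter fun i ↦ (i : ℕ) < p ∧ p ≤ (i : ℕ) + m

lemma monotone_rightChain (p : ℕ) : Monotone (rightChain n p) := by
  intro m l h i
  simp only [rightChain, Finset.mem_filter, Finset.mem_univ, true_and]
  omega

lemma monotone_leftChain (p : ℕ) : Monotone (leftChain n p) := by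
  intro m l h i
  simp only [leftChain, Finset.mem_filter, Finset.mem_univ, true_and]
  omega

/-- The pieces of `v - θ` are a prefix, an interval ending or starting at `p`, and a suffix, so four
chains serve all `m` at once. -/
lemma exists_inner_sub_sq_le {p : ℕ} (hp : p ≤ n) {θ : EuclideanSpace ℝ (Fin n)}
    (hθ : θ ∈ twoPieceSpace n p) :
    ∃ G : EuclideanSpace ℝ (Fin n) → ℝ,
      (∀ z, ∀ m ≤ n, ∀ v ∈ twoPieceSpace n m, inner ℝ z (v - θ) ^ 2 ≤ G z * ‖v - θ‖ ^ 2) ∧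
      ∫⁻ z, ENNReal.ofReal (G z) ∂(stdGaussian (EuclideanSpace ℝ (Fin n))) ≤
        ENNReal.ofReal (32 * (Real.log (4 * (Nat.log 2 n + 1 : ℕ)) + 1)) := by
  obtain ⟨s, t, hθ⟩ := hθ
  obtain ⟨G₁, hm₁, h0₁, hle₁, hint₁⟩ := exists_coordSum_sq_le (monotone_rightChain (n := n) 0) (n + 1)
  obtain ⟨G₂, hm₂, h0₂, hle₂, hint₂⟩ := exists_coordSum_sq_le (monotone_rightChain (n := n) p) (n + 1)
  obtain ⟨G₃, hm₃, h0₃, hle₃, hint₃⟩ := exists_coordSum_sq_le (monotone_leftChain (n := n) p) (n + 1)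
  obtain ⟨G₄, hm₄, h0₄, hle₄, hint₄⟩ := exists_coordSum_sq_le (monotone_leftChain (n := n) n) (n + 1)
  refine ⟨fun z ↦ G₁ z + G₂ z + G₃ z + G₄ z, fun z m hm v ⟨α, β, hv⟩ ↦ ?_, ?_⟩
  · have h1 := h0₁ z
    have h2 := h0₂ z
    have h3 := h0₃ z
    have h4 := h0₄ z
    rcases le_total m p with hmp | hmp
    · have key := inner_sq_le_of_three_pieces (w := v - θ) (a := α - s) (b := β - s) (c := β - t)
        (I₁ := rightChain n 0 m) (I₂ := leftChain n p (p - m)) (I₃ := leftChain n n (n - p))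
        (fun i ↦ ?_) h1 h3 h4 (hle₁ z m (by omega)) (hle₃ z (p - m) (by omega))
        (hle₄ z (n - p) (by omega))
      · refine key.trans ?_
        gcongr
        linarith
      · have hi := i.2
        simp only [rightChain, leftChain, Finset.mem_filter, Finset.mem_univ, true_and,
          PiLp.sub_apply, hv, hθ]
        by_cases hi1 : (i : ℕ) < m
        · refine Or.inl ⟨by omega, by omega, by omega, ?_⟩
          rw [if_pos hi1, if_pos (by omega)]
        · by_cases hi2 : (i : ℕ) < p
          · refine Or.inr (Or.inl ⟨by omega, by omega, by omega, ?_⟩)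
            rw [if_neg hi1, if_pos hi2]
          · refine Or.inr (Or.inr ⟨by omega, by omega, by omega, ?_⟩)
            rw [if_neg hi1, if_neg hi2]
    · have key := inner_sq_le_of_three_pieces (w := v - θ) (a := α - s) (b := α - t) (c := β - t)
        (I₁ := rightChain n 0 p) (I₂ := rightChain n p (m - p)) (I₃ := leftChain n n (n - m))
        (fun i ↦ ?_) h1 h2 h4 (hle₁ z p (by omega)) (hle₂ z (m - p) (by omega))
        (hle₄ z (n - m) (by omega))
      · refine key.trans ?_
        gcongr
        linarith
      · have hi := i.2
        simp only [rightChain, leftChain, Finset.mem_filter, Finset.mem_univ, true_and,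
          PiLp.sub_apply, hv, hθ]
        by_cases hi1 : (i : ℕ) < p
        · refine Or.inl ⟨by omega, by omega, by omega, ?_⟩
          rw [if_pos hi1, if_pos (by omega)]
        · by_cases hi2 : (i : ℕ) < m
          · refine Or.inr (Or.inl ⟨by omega, by omega, by omega, ?_⟩)
            rw [if_neg hi1, if_pos hi2]
          · refine Or.inr (Or.inr ⟨by omega, by omega, by omega, ?_⟩)
            rw [if_neg hi1, if_neg hi2]
  · set R := 8 * (Real.log (4 * (Nat.log 2 n + 1 : ℕ)) + 1) with hR
    have hR0 : 0 ≤ R := by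
      have h : (1 : ℝ) ≤ (Nat.log 2 n + 1 : ℕ) := by exact_mod_cast Nat.succ_pos _
      have := Real.log_nonneg (show (1 : ℝ) ≤ 4 * (Nat.log 2 n + 1 : ℕ) by linarith)
      positivity
    have hsum (z) : ENNReal.ofReal (G₁ z + G₂ z + G₃ z + G₄ z) = ENNReal.ofReal (G₁ z) +
        ENNReal.ofReal (G₂ z) + ENNReal.ofReal (G₃ z) + ENNReal.ofReal (G₄ z) := by
      have h1 := h0₁ z
      have h2 := h0₂ z
      have h3 := h0₃ z
      rw [ENNReal.ofReal_add (by positivity) (h0₄ z), ENNReal.ofReal_add (by positivity) h3,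
        ENNReal.ofReal_add h1 h2]
    simp_rw [hsum]
    rw [lintegral_add_left (by fun_prop), lintegral_add_left (by fun_prop),
      lintegral_add_left (by fun_prop)]
    calc _ ≤ ENNReal.ofReal R + ENNReal.ofReal R + ENNReal.ofReal R + ENNReal.ofReal R := by gcongr
      _ = _ := by
        rw [← ENNReal.ofReal_add (by positivity) (by positivity),
          ← ENNReal.ofReal_add (by positivity) (by positivity),
          ← ENNReal.ofReal_add (by positivity) (by positivity)]
        congr 1
        ring

/-- With `x = log (16 n)`: the factor `16` makes `x > e`, so `1 ≤ log x`, and `4 (L + 1) ≤ x³` gives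
the remaining `3 log x`. -/
lemma log_add_one_le_log_log (hn : 1 ≤ n) :
    Real.log (4 * (Nat.log 2 n + 1 : ℕ)) + 1 ≤ 4 * Real.log (Real.log (16 * n)) := by
  set L := Nat.log 2 n
  set x := Real.log (16 * n)
  have hL : (2 : ℝ) ^ L ≤ n := by exact_mod_cast Nat.pow_log_le_self 2 (by omega)
  have h2 := Real.log_two_gt_d9
  have hx : (4 + L) * 0.6931471803 ≤ x := by
    calc (4 + L) * 0.6931471803 ≤ (4 + L) * Real.log 2 := by gcongr
      _ = Real.log (2 ^ (4 + L)) := by rw [Real.log_pow]; push_cast; ring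
      _ ≤ x := by
        refine Real.log_le_log (by positivity) ?_
        rw [pow_add]
        norm_num
        exact hL
  have hL0 : (0 : ℝ) ≤ L := by positivity
  have hx1 : 2.7725 ≤ x := by norm_num at hx ⊢; linarith
  have hlog : 1 ≤ Real.log x := by
    rw [Real.le_log_iff_exp_le (by linarith)]
    have := Real.exp_one_lt_d9
    norm_num at this hx1 ⊢
    linarith
  have hK : (4 * (L + 1 : ℕ) : ℝ) ≤ x ^ 3 := by
    push_cast
    nlinarith [mul_le_mul hx1 hx1 (by norm_num) (by linarith)]
  have := Real.log_le_log (by positivity) hK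
  rw [Real.log_pow] at this
  push_cast at this ⊢
  linarith

lemma minimaxRisk_Theta_two_le (hn : 1 ≤ n) {σ : ℝ} (hσ : 0 < σ) :
    minimaxRisk n σ (Theta n 2) ≤
      ENNReal.ofReal (512 * (σ ^ 2 * Real.log (Real.log (16 * n)))) := by
  refine (minimaxRisk_le_of_forall_inner_sq_le hσ (fun m : Fin (n + 1) ↦ twoPieceSpace n m)
    (B := 32 * (Real.log (4 * (Nat.log 2 n + 1 : ℕ)) + 1)) fun θ hθ ↦ ?_).trans (ENNReal.ofReal_le_ofReal ?_)
  · obtain ⟨p, hp, hθ⟩ := Theta_two_apply hθ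
    obtain ⟨G, hG, hint⟩ := exists_inner_sub_sq_le hp (θ := θ) hθ
    exact ⟨⟨⟨p, by omega⟩, hθ⟩, G, fun z m v hv ↦ hG z m (by omega) v hv, hint⟩
  · have := log_add_one_le_log_log hn
    nlinarith [sq_nonneg σ]

end TwoPieces

end PiecewiseConstant

theorem theorem4p1 :
    ∃ c C : ℝ, 0 < c ∧ 0 < C ∧
      ∀ (n k : ℕ) (σ : ℝ), 1 ≤ k → k ≤ n → 0 < σ →
        ENNReal.ofReal (c * PiecewiseConstant.rate n k σ)
            ≤ PiecewiseConstant.minimaxRisk n σ (PiecewiseConstant.Theta n k) ∧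
          PiecewiseConstant.minimaxRisk n σ (PiecewiseConstant.Theta n k)
            ≤ ENNReal.ofReal (C * PiecewiseConstant.rate n k σ) := by
  open PiecewiseConstant in
  -- The extreme constants of the three regimes, both attained at `k = 2`.
  refine ⟨1 / 320, 512, by norm_num, by norm_num, fun n k σ hk hkn hσ ↦ ?_⟩
  have hσ2 : 0 < σ ^ 2 := by positivity
  obtain rfl | rfl | hk3 : k = 1 ∨ k = 2 ∨ 3 ≤ k := by omega
  · rw [rate, if_pos rfl]
    exact ⟨(ENNReal.ofReal_le_ofReal (by linarith)).trans (le_minimaxRisk_Theta_one hkn hσ),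
      (minimaxRisk_Theta_one_le hσ).trans (ENNReal.ofReal_le_ofReal (by linarith))⟩
  · rw [rate, if_neg (by norm_num), if_pos rfl]
    exact ⟨le_minimaxRisk_Theta_two (by omega) hσ, minimaxRisk_Theta_two_le (by omega) hσ⟩
  · rw [rate, if_neg (by omega), if_neg (by omega)]
    have hl := one_le_log_exp_mul_div hk hkn
    have h : 0 ≤ σ ^ 2 * k * Real.log (Real.exp 1 * n / k) := by positivity
    exact ⟨(ENNReal.ofReal_le_ofReal (by linarith)).trans (le_minimaxRisk_Theta hk3 hkn hσ),
      (minimaxRisk_Theta_le hσ (by omega) hkn).trans (ENNReal.ofReal_le_ofReal (by linarith))⟩
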